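/- Let $p,q\in\mathbb C$ with $0<|p|<1$ and $0<|q|<1$. Put $(z;p)_\infty=\prod_{j=0}^\infty(1-zp^j)$ and let $$\Gamma(z;p,q)=\prod_{j,k=0}^\infty\frac{1-z^{-1}p^{j+1}q^{k+1}}{1-zp^jq^k},\qquad z\in\mathbb C\setminus\{0\},$$ be the elliptic gamma function; write $\Gamma(tz^{\pm k};p,q)=\Gamma(tz^{k};p,q)\,\Gamma(tz^{-k};p,q)$. Let $t_1,\dots,t_6\in\mathbb C$ satisfy $|t_j|<1$ for all $j$ and $\prod_{j=1}^6t_j=pq$. Then the integral below converges and $$\frac{(p;p)_\infty(q;q)_\infty}{4\pi \mathrm i}\int_{\mathbb T}\frac{\prod_{j=1}^6\Gamma(t_jz^{\pm1};p,q)}{\Gamma(z^{\pm2};p,q)}\,\frac{dz}{z}=\prod_{1\le j<k\le6}\Gamma(t_jt_k;p,q),$$ where $\mathbb T$ is the unit circle with positive orientation and $1/\Gamma(z^{\pm2};p,q)$ is read as $0$ at $z=\pm1$, where $\Gamma(z^{\pm 2};p,q)$ has a pole. -/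

import Mathlib

/-- The infinite `q`-Pochhammer symbol `(z; p)_∞ = ∏_{j ≥ 0} (1 - z p^j)`, for `|p| < 1`. -/
noncomputable def qPochhammerInf (z p : ℂ) : ℂ :=
  ∏' j : ℕ, (1 - z * p ^ j)

/-- The elliptic gamma function
`Γ(z; p, q) = ∏_{j, k ≥ 0} (1 - z⁻¹ p^(j+1) q^(k+1)) / (1 - z p^j q^k)`,
for `|p|, |q| < 1` and `z ≠ 0`, as an unconditional product over all pairs `(j, k)`.
At a pole (where `z p^j q^k = 1` for some `j, k`) the value here is `0`, by the convention
`x / 0 = 0`; hence `1 / Γ` is `0` there, which is the value of the holomorphic function `1 / Γ`. -/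
noncomputable def ellipticGamma (z p q : ℂ) : ℂ :=
  ∏' n : ℕ × ℕ, (1 - z⁻¹ * p ^ (n.1 + 1) * q ^ (n.2 + 1)) / (1 - z * p ^ n.1 * q ^ n.2)

/-- The product defining `(z; p)_∞` converges unconditionally for `|p| < 1`. -/
theorem multipliable_qPochhammerInf (z : ℂ) {p : ℂ} (hp : ‖p‖ < 1) :
    Multipliable fun j : ℕ => 1 - z * p ^ j := by
  have h : Summable fun j : ℕ => ‖-(z * p ^ j)‖ := by
    simpa using (summable_geometric_of_lt_one (norm_nonneg p) hp).mul_left ‖z‖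
  simpa [sub_eq_add_neg] using multipliable_one_add_of_summable h

/-- The product defining `Γ(z; p, q)` converges unconditionally for `|p|, |q| < 1`. -/
theorem multipliable_ellipticGamma (z : ℂ) {p q : ℂ} (hp : ‖p‖ < 1) (hq : ‖q‖ < 1) :
    Multipliable fun n : ℕ × ℕ =>
      (1 - z⁻¹ * p ^ (n.1 + 1) * q ^ (n.2 + 1)) / (1 - z * p ^ n.1 * q ^ n.2) := by
  have hs : Summable fun n : ℕ × ℕ => p ^ n.1 * q ^ n.2 := by
    refine Summable.of_norm ?_
    simpa using (summable_geometric_of_lt_one (norm_nonneg p) hp).mul_of_nonneg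
      (summable_geometric_of_lt_one (norm_nonneg q) hq)
      (fun _ => pow_nonneg (norm_nonneg p) _) (fun _ => pow_nonneg (norm_nonneg q) _)
  have hd := ((hs.mul_left z).tendsto_cofinite_zero).norm
  rw [norm_zero] at hd
  have he := hd.eventually (gt_mem_nhds (show (0 : ℝ) < 1 / 2 by norm_num))
  have key : Summable fun n : ℕ × ℕ =>
      ‖(1 - z⁻¹ * p ^ (n.1 + 1) * q ^ (n.2 + 1)) / (1 - z * p ^ n.1 * q ^ n.2) - 1‖ := by
    refine Summable.norm ?_
    refine Summable.of_norm_bounded_eventually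
      (g := fun n : ℕ × ℕ => 2 * (‖z - z⁻¹ * p * q‖ * ‖p ^ n.1 * q ^ n.2‖))
      ((hs.norm.mul_left _).mul_left 2) ?_
    filter_upwards [he] with n hn
    have h1 : (1 / 2 : ℝ) ≤ ‖1 - z * p ^ n.1 * q ^ n.2‖ := by
      have h2 := norm_sub_norm_le (1 : ℂ) (z * p ^ n.1 * q ^ n.2)
      rw [norm_one, mul_assoc] at h2
      rw [mul_assoc]
      linarith
    have h0 : 1 - z * p ^ n.1 * q ^ n.2 ≠ 0 := by
      intro h
      rw [h, norm_zero] at h1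
      norm_num at h1
    have e : (1 - z⁻¹ * p ^ (n.1 + 1) * q ^ (n.2 + 1)) / (1 - z * p ^ n.1 * q ^ n.2) - 1
        = ((z - z⁻¹ * p * q) * (p ^ n.1 * q ^ n.2)) / (1 - z * p ^ n.1 * q ^ n.2) := by
      rw [div_sub_one h0]
      congr 1
      ring
    rw [e, norm_div, norm_mul, div_le_iff₀ (by linarith)]
    nlinarith [mul_nonneg (norm_nonneg (z - z⁻¹ * p * q)) (norm_nonneg (p ^ n.1 * q ^ n.2))]
  simpa using multipliable_one_add_of_summable key

/-- The integrand of the elliptic beta integral with respect to `dz`,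
`(∏_{j=1}^6 Γ(t_j z^{±1}; p, q)) / Γ(z^{±2}; p, q) · 1/z`, where
`Γ(t z^{±k}; p, q)` means `Γ(t z^k; p, q) Γ(t z^{-k}; p, q)`. -/
noncomputable def ellipticBetaIntegrand (t : Fin 6 → ℂ) (p q z : ℂ) : ℂ :=
  (∏ j : Fin 6, ellipticGamma (t j * z) p q * ellipticGamma (t j * z⁻¹) p q) /
    (ellipticGamma (z ^ 2) p q * ellipticGamma ((z ^ 2)⁻¹) p q) * (1 / z)

/-!
The proof compares the two sides as functions of the parameters. The integral is written as a mean
value over the unit circle (`betaMean`), with `1 / Γ(z^{±2}; p, q)` replaced by the equal product of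
theta functions `θ(z²; p) θ(z⁻²; q)`; dividing by `∏_{j < k} Γ(t_j t_k; p, q)`, which does not vanish
for balanced parameters, gives `betaRatio`, and the claim is that this is the constant
`2 / ((p; p)_∞ (q; q)_∞)`.

*Difference equation.* Let `t, u, s₁, …, s₄` lie in the unit disc and have product `p`. A theta
function identity (`modThetaProd_sub_eq`) expresses
`∏ θ(s_m t) θ(u z^{±1}) - ∏ θ(s_m u) θ(t z^{±1})` as a sum `f(z) + f(1 / z)`, and the integral
of `f` against the common part of the integrands vanishes, because after moving the contour to
`|z| = |q|^{-1/2}` the integrand is odd under `z ↦ 1 / (q z)`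
(`circleAverage_ellipticGamma_eq_zero`). Hence `betaRatio` takes the same value at `(q t, u, s)` and
at `(t, q u, s)`. The theta identity holds because the odd theta functions of degree six form a
space of dimension two: their Laurent coefficients satisfy a recursion that leaves two of them free.

*Two parameters with fixed product.* With `B = t u` and `s` fixed, `betaRatio` is a holomorphic
function of `t` on the annulus `|B| < |t| < 1`, invariant under multiplication by `q`. If
`|B| < |q|`, the annulus contains a fundamental domain of the torus `ℂˣ / q^ℤ`, so the function is
constant by the maximum principle (`betaRatio_eq_of_norm_lt`).

*The constant.* If `|t₁ t₂| < |q|`, two such moves take the parameters to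
`(i r, -i r, t₁ t₂ t₃ / r², t₄, t₅, t₆)` for all `r` close to `1`. As `r → 1`, the product
`(1 - r⁴) Γ(i r z^{±1}) Γ(-i r z^{±1})` becomes a Poisson kernel in `z²` concentrating at `z = ± i`,
and evaluating there gives the constant (`betaRatio_eq_of_eq_on_family`).

*All parameters.* By symmetry `|p| ≤ |q|`. The identity theorem on annuli extends the evaluation to
`|t₁ t₂ t₃| < |q|` and then to `|t₁ t₂ t₃ t₄| < |q|`, and the four smallest parameters
satisfy the last condition.
-/

open Filter Topology

/-! ### Infinite products -/

theorem differentiable_tprod_one_sub_mul {ι : Type*} {a : ι → ℂ} (ha : Summable fun i => ‖a i‖) :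
    Differentiable ℂ fun z : ℂ => ∏' i, (1 - z * a i) := by
  intro z₀
  have h := Summable.hasProdLocallyUniformlyOn_one_add (f := fun i z => -(z * a i))
    (K := Metric.ball (0 : ℂ) (‖z₀‖ + 1)) Metric.isOpen_ball
    (u := fun i => (‖z₀‖ + 1) * ‖a i‖) (ha.mul_left _)
    (Eventually.of_forall fun i z hz => by
      rw [norm_neg, norm_mul]
      exact mul_le_mul_of_nonneg_right (by simpa using (mem_ball_zero_iff.1 hz).le)
        (norm_nonneg _))
    (fun i => by fun_prop)
  have h2 := h.differentiableOn (Eventually.of_forall fun s => by fun_prop)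
    Metric.isOpen_ball
  have h3 := h2.differentiableAt (Metric.isOpen_ball.mem_nhds
    (show z₀ ∈ Metric.ball (0 : ℂ) (‖z₀‖ + 1) by simp))
  simpa only [← sub_eq_add_neg] using h3

theorem tprod_one_sub_mul_ne_zero {ι : Type*} {a : ι → ℂ} (ha : Summable fun i => ‖a i‖) {z : ℂ}
    (hz : ∀ i, z * a i ≠ 1) : ∏' i, (1 - z * a i) ≠ 0 := by
  have := tprod_one_add_ne_zero_of_summable (f := fun i => -(z * a i))
    (fun i => by rw [← sub_eq_add_neg]; exact sub_ne_zero.2 (hz i).symm)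
    (by simpa using ha.mul_left ‖z‖)
  simpa only [← sub_eq_add_neg] using this

theorem summable_norm_pow {p : ℂ} (hp : ‖p‖ < 1) : Summable fun j : ℕ => ‖p ^ j‖ := by
  simpa using summable_geometric_of_lt_one (norm_nonneg p) hp

theorem summable_norm_pow_mul_pow {p q : ℂ} (hp : ‖p‖ < 1) (hq : ‖q‖ < 1) :
    Summable fun n : ℕ × ℕ => ‖p ^ n.1 * q ^ n.2‖ := by
  simpa using (summable_geometric_of_lt_one (norm_nonneg p) hp).mul_of_nonneg
      (summable_geometric_of_lt_one (norm_nonneg q) hq)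
      (fun _ => pow_nonneg (norm_nonneg p) _) (fun _ => pow_nonneg (norm_nonneg q) _)

theorem mul_ne_one_of_norm_lt {x y : ℂ} (hx : ‖x‖ < 1) (hy : ‖y‖ ≤ 1) : x * y ≠ 1 := by
  intro h
  have h2 := congrArg norm h
  rw [norm_mul, norm_one] at h2
  nlinarith [norm_nonneg x, norm_nonneg y]

section QPochhammer

variable {p : ℂ}

theorem differentiable_qPochhammerInf (hp : ‖p‖ < 1) :
    Differentiable ℂ fun z => qPochhammerInf z p :=
  differentiable_tprod_one_sub_mul (summable_norm_pow hp)

theorem qPochhammerInf_ne_zero (hp : ‖p‖ < 1) {z : ℂ} (hz : ∀ j : ℕ, z * p ^ j ≠ 1) :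
    qPochhammerInf z p ≠ 0 :=
  tprod_one_sub_mul_ne_zero (summable_norm_pow hp) hz

theorem qPochhammerInf_ne_zero_of_norm_lt_one (hp : ‖p‖ < 1) {z : ℂ} (hz : ‖z‖ < 1) :
    qPochhammerInf z p ≠ 0 :=
  qPochhammerInf_ne_zero hp fun j => mul_ne_one_of_norm_lt hz (by
    rw [norm_pow]; exact pow_le_one₀ (norm_nonneg _) hp.le)

theorem qPochhammerInf_eq_one_sub_mul (hp : ‖p‖ < 1) (z : ℂ) :
    qPochhammerInf z p = (1 - z) * qPochhammerInf (p * z) p := by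
  have h := multipliable_qPochhammerInf (p * z) hp
  unfold qPochhammerInf
  rw [tprod_eq_zero_mul']
  · congr 1
    · simp
    · exact tprod_congr fun j => by ring
  · exact h.congr fun j => by ring

end QPochhammer

/-- The double `(p, q)`-Pochhammer symbol `(z; p, q)_∞ = ∏_{j, k ≥ 0} (1 - z p^j q^k)`. -/
noncomputable def doublePochhammer (z p q : ℂ) : ℂ :=
  ∏' n : ℕ × ℕ, (1 - z * (p ^ n.1 * q ^ n.2))

section DoublePochhammer

variable {p q : ℂ}

theorem multipliable_doublePochhammer (hp : ‖p‖ < 1) (hq : ‖q‖ < 1) (z : ℂ) :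
    Multipliable fun n : ℕ × ℕ => 1 - z * (p ^ n.1 * q ^ n.2) := by
  have h : Summable fun n : ℕ × ℕ => ‖-(z * (p ^ n.1 * q ^ n.2))‖ := by
    simpa using (summable_norm_pow_mul_pow hp hq).mul_left ‖z‖
  simpa [sub_eq_add_neg] using multipliable_one_add_of_summable h

theorem differentiable_doublePochhammer (hp : ‖p‖ < 1) (hq : ‖q‖ < 1) :
    Differentiable ℂ fun z => doublePochhammer z p q :=
  differentiable_tprod_one_sub_mul (summable_norm_pow_mul_pow hp hq)

theorem doublePochhammer_ne_zero (hp : ‖p‖ < 1) (hq : ‖q‖ < 1) {z : ℂ} (hz : ‖z‖ < 1) :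
    doublePochhammer z p q ≠ 0 :=
  tprod_one_sub_mul_ne_zero (summable_norm_pow_mul_pow hp hq) fun n =>
    mul_ne_one_of_norm_lt hz (by
      rw [norm_mul, norm_pow, norm_pow]
      exact mul_le_one₀ (pow_le_one₀ (norm_nonneg _) hp.le) (by positivity)
        (pow_le_one₀ (norm_nonneg _) hq.le))

theorem doublePochhammer_symm (z p q : ℂ) : doublePochhammer z p q = doublePochhammer z q p := by
  unfold doublePochhammer
  rw [← (Equiv.prodComm ℕ ℕ).tprod_eq]
  exact tprod_congr fun n => by simp [mul_comm]

theorem doublePochhammer_eq_mul_left (hp : ‖p‖ < 1) (hq : ‖q‖ < 1) (z : ℂ) :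
    doublePochhammer z p q = qPochhammerInf z q * doublePochhammer (p * z) p q := by
  have key : ∀ w : ℂ, HasProd (fun j : ℕ => qPochhammerInf (w * p ^ j) q)
      (doublePochhammer w p q) := fun w =>
    (multipliable_doublePochhammer hp hq w).hasProd.prod_fiberwise fun j => by
      refine (multipliable_qPochhammerInf (w * p ^ j) hq).hasProd.congr_fun ?_
      intro k; ring
  rw [← (key z).tprod_eq, tprod_eq_zero_mul', ← (key (p * z)).tprod_eq]
  · congr 1
    · simp
    · exact tprod_congr fun j => by ring_nf
  · exact (key (p * z)).multipliable.congr fun j => by ring_nf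

theorem doublePochhammer_eq_mul_right (hp : ‖p‖ < 1) (hq : ‖q‖ < 1) (z : ℂ) :
    doublePochhammer z p q = qPochhammerInf z p * doublePochhammer (q * z) p q := by
  rw [doublePochhammer_symm z, doublePochhammer_eq_mul_left hq hp, doublePochhammer_symm _ q p]

end DoublePochhammer

/-! ### The elliptic gamma function -/

section EllipticGamma

variable {p q : ℂ}

theorem ellipticGamma_eq_div (hp : ‖p‖ < 1) (hq : ‖q‖ < 1) (z : ℂ) :
    ellipticGamma z p q = doublePochhammer (p * q / z) p q / doublePochhammer z p q := by
  by_cases h : ∃ n : ℕ × ℕ, z * (p ^ n.1 * q ^ n.2) = 1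
  · obtain ⟨n, hn⟩ := h
    have h1 : doublePochhammer z p q = 0 := by
      unfold doublePochhammer
      exact tprod_of_exists_eq_zero ⟨n, by rw [hn, sub_self]⟩
    rw [h1, div_zero]
    unfold ellipticGamma
    exact tprod_of_exists_eq_zero ⟨n, by rw [mul_assoc z, hn, sub_self, div_zero]⟩
  · push Not at h
    have h0 : doublePochhammer z p q ≠ 0 :=
      tprod_one_sub_mul_ne_zero (summable_norm_pow_mul_pow hp hq) h
    rw [eq_div_iff h0]
    unfold ellipticGamma doublePochhammer
    rw [← (multipliable_ellipticGamma z hp hq).tprod_mul (multipliable_doublePochhammer hp hq z)]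
    refine tprod_congr fun n => ?_
    have h1 : 1 - z * (p ^ n.1 * q ^ n.2) ≠ 0 := sub_ne_zero.2 (h n).symm
    rw [mul_assoc z, div_mul_cancel₀ _ h1]
    ring

theorem ellipticGamma_symm (hp : ‖p‖ < 1) (hq : ‖q‖ < 1) (z : ℂ) :
    ellipticGamma z p q = ellipticGamma z q p := by
  rw [ellipticGamma_eq_div hp hq, ellipticGamma_eq_div hq hp, doublePochhammer_symm _ p,
    doublePochhammer_symm _ p, mul_comm p]

theorem differentiableAt_ellipticGamma (hp : ‖p‖ < 1) (hq : ‖q‖ < 1) {z : ℂ} (h0 : z ≠ 0)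
    (hz : ‖z‖ < 1) : DifferentiableAt ℂ (fun z => ellipticGamma z p q) z := by
  simp only [ellipticGamma_eq_div hp hq]
  have h := differentiable_doublePochhammer hp hq
  refine DifferentiableAt.div ?_ (h z) (doublePochhammer_ne_zero hp hq hz)
  exact (h _).comp z (f := fun z => p * q / z) (by fun_prop (disch := assumption))

theorem ellipticGamma_ne_zero (hp : ‖p‖ < 1) (hq : ‖q‖ < 1) {z : ℂ} (hz : ‖z‖ < 1)
    (hz' : ‖p * q / z‖ < 1) : ellipticGamma z p q ≠ 0 := by
  rw [ellipticGamma_eq_div hp hq]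
  exact div_ne_zero (doublePochhammer_ne_zero hp hq hz') (doublePochhammer_ne_zero hp hq hz)

/-- The reflection formula `Γ(z; p, q) Γ(p q / z; p, q) = 1`. -/
theorem ellipticGamma_mul_ellipticGamma_of_mul_eq (hp0 : p ≠ 0) (hq0 : q ≠ 0) (hp : ‖p‖ < 1)
    (hq : ‖q‖ < 1) {z w : ℂ} (hz : ‖z‖ < 1) (hw : ‖w‖ < 1) (h : z * w = p * q) :
    ellipticGamma z p q * ellipticGamma w p q = 1 := by
  have hpq : z * w ≠ 0 := h ▸ mul_ne_zero hp0 hq0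
  have hz0 := left_ne_zero_of_mul hpq
  have hw0 := right_ne_zero_of_mul hpq
  rw [ellipticGamma_eq_div hp hq, ellipticGamma_eq_div hp hq, ← h,
    mul_div_cancel_left₀ _ hz0, mul_div_cancel_right₀ _ hw0]
  have h1 := doublePochhammer_ne_zero hp hq hz
  have h2 := doublePochhammer_ne_zero hp hq hw
  field_simp

end EllipticGamma

/-- The modified theta function `θ(z; p) = (z; p)_∞ (p / z; p)_∞`, for `z ≠ 0`. -/
noncomputable def modTheta (z p : ℂ) : ℂ :=
  qPochhammerInf z p * qPochhammerInf (p / z) p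

section ModTheta

variable {p : ℂ}

theorem differentiableAt_modTheta (hp : ‖p‖ < 1) {z : ℂ} (hz : z ≠ 0) :
    DifferentiableAt ℂ (fun z => modTheta z p) z := by
  have h := differentiable_qPochhammerInf hp
  refine (h z).mul ?_
  exact (h _).comp z (f := fun z => p / z) (by fun_prop (disch := assumption))

theorem modTheta_ne_zero_of_norm (hp : ‖p‖ < 1) {z : ℂ} (hz : ‖z‖ < 1) (hz' : ‖p‖ < ‖z‖) :
    modTheta z p ≠ 0 := by
  refine mul_ne_zero (qPochhammerInf_ne_zero_of_norm_lt_one hp hz)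
    (qPochhammerInf_ne_zero_of_norm_lt_one hp ?_)
  rw [norm_div]
  exact (div_lt_one ((norm_nonneg p).trans_lt hz')).2 hz'

theorem modTheta_ne_zero (hp0 : p ≠ 0) (hp : ‖p‖ < 1) {z : ℂ} (hz0 : z ≠ 0)
    (hz : ∀ n : ℤ, z ≠ p ^ n) : modTheta z p ≠ 0 := by
  refine mul_ne_zero (qPochhammerInf_ne_zero hp fun j hj => ?_)
    (qPochhammerInf_ne_zero hp fun j hj => ?_)
  · refine hz (-j) ?_
    rw [zpow_neg, zpow_natCast]
    exact eq_inv_of_mul_eq_one_left hj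
  · refine hz (j + 1) ?_
    rw [div_mul_eq_mul_div, div_eq_one_iff_eq hz0] at hj
    rw [zpow_add_one₀ hp0, zpow_natCast, ← hj, mul_comm]

theorem modTheta_one (hp : ‖p‖ < 1) : modTheta 1 p = 0 := by
  rw [modTheta, qPochhammerInf_eq_one_sub_mul hp]
  simp

theorem modTheta_inv (hp : ‖p‖ < 1) {z : ℂ} (hz : z ≠ 0) :
    modTheta z⁻¹ p = -z⁻¹ * modTheta z p := by
  unfold modTheta
  rw [qPochhammerInf_eq_one_sub_mul hp z⁻¹, qPochhammerInf_eq_one_sub_mul hp z, div_inv_eq_mul,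
    ← div_eq_mul_inv]
  field_simp
  ring

theorem modTheta_mul (hp0 : p ≠ 0) (hp : ‖p‖ < 1) {z : ℂ} (hz : z ≠ 0) :
    modTheta (p * z) p = -z⁻¹ * modTheta z p := by
  unfold modTheta
  have h : p / (p * z) = z⁻¹ := by field_simp
  rw [h, qPochhammerInf_eq_one_sub_mul hp z⁻¹, qPochhammerInf_eq_one_sub_mul hp z,
    ← div_eq_mul_inv]
  field_simp
  ring

theorem modTheta_div (hp0 : p ≠ 0) (hp : ‖p‖ < 1) {z : ℂ} (hz : z ≠ 0) :
    modTheta (z / p) p = -(z / p) * modTheta z p := by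
  have h := modTheta_mul hp0 hp (div_ne_zero hz hp0)
  rw [mul_div_cancel₀ _ hp0] at h
  rw [h]
  field_simp

theorem modTheta_sq_mul (hp0 : p ≠ 0) (hp : ‖p‖ < 1) {z : ℂ} (hz : z ≠ 0) :
    modTheta (p ^ 2 * z) p = (p * z ^ 2)⁻¹ * modTheta z p := by
  rw [pow_two, mul_assoc, modTheta_mul hp0 hp (mul_ne_zero hp0 hz), modTheta_mul hp0 hp hz]
  field_simp

variable {q : ℂ}

theorem ellipticGamma_mul_right (hp : ‖p‖ < 1) (hq0 : q ≠ 0) (hq : ‖q‖ < 1) {z : ℂ}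
    (hz : ‖z‖ < 1) :
    ellipticGamma (q * z) p q = modTheta z p * ellipticGamma z p q := by
  have h : p * q / (q * z) = p / z := by
    rw [mul_comm p, mul_div_mul_left _ _ hq0]
  rw [ellipticGamma_eq_div hp hq, ellipticGamma_eq_div hp hq, h,
    doublePochhammer_eq_mul_right hp hq z, doublePochhammer_eq_mul_right hp hq (p / z), modTheta]
  have h1 := qPochhammerInf_ne_zero_of_norm_lt_one hp hz
  rw [show q * (p / z) = p * q / z by ring]
  field_simp

/-- On the unit circle `1 / (Γ(z; p, q) Γ(1 / z; p, q)) = θ(z; p) θ(1 / z; q)`; at `z = 1` both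
sides vanish, the left one because `Γ(1; p, q)` has the junk value `0`. -/
theorem inv_ellipticGamma_mul_inv (hp : ‖p‖ < 1) (hq : ‖q‖ < 1) {z : ℂ} (hz : ‖z‖ = 1) :
    (ellipticGamma z p q * ellipticGamma z⁻¹ p q)⁻¹ = modTheta z p * modTheta z⁻¹ q := by
  have hz0 : z ≠ 0 := by intro h; simp [h] at hz
  have hn : ∀ w : ℂ, ‖w‖ = 1 → doublePochhammer (p * q * w) p q ≠ 0 := fun w hw =>
    doublePochhammer_ne_zero hp hq (by
      rw [norm_mul, norm_mul, hw, mul_one]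
      exact mul_lt_one_of_nonneg_of_lt_one_left (norm_nonneg _) hp hq.le)
  have h1 := hn z hz
  have h2 := hn z⁻¹ (by rw [norm_inv, hz, inv_one])
  rw [ellipticGamma_eq_div hp hq, ellipticGamma_eq_div hp hq, modTheta, modTheta, div_inv_eq_mul,
    div_inv_eq_mul, div_eq_mul_inv (p * q) z, div_eq_mul_inv p z, mul_inv, inv_div, inv_div,
    doublePochhammer_eq_mul_right hp hq z, doublePochhammer_eq_mul_left hp hq (q * z),
    doublePochhammer_eq_mul_left hp hq z⁻¹, doublePochhammer_eq_mul_right hp hq (p * z⁻¹),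
    ← mul_assoc p q z, ← mul_assoc q p z⁻¹, mul_comm q p]
  rw [div_mul_div_comm, div_eq_iff (mul_ne_zero _ _)]
  · ring
  · simpa [div_eq_mul_inv] using h2
  · simpa [div_eq_mul_inv] using h1

end ModTheta

/-! ### Averages over circles -/

section CircleAverage

open Real

theorem circleAverage_comp_mul (F : ℂ → ℂ) (a : ℂ) (r : ℝ) :
    circleAverage (fun z => F (a * z)) 0 r = circleAverage F 0 (‖a‖ * r) := by
  rw [circleAverage_eq_integral_add (R := ‖a‖ * r) a.arg, circleAverage_def]
  congr 1
  refine intervalIntegral.integral_congr fun θ _ => ?_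
  simp only [circleMap, zero_add]
  congr 1
  nth_rewrite 1 [← Complex.norm_mul_exp_arg_mul_I a]
  push_cast
  rw [add_mul, Complex.exp_add]
  ring

theorem circleAverage_comp_inv (F : ℂ → ℂ) (r : ℝ) :
    circleAverage (fun z => F z⁻¹) 0 r = circleAverage F 0 r⁻¹ := by
  rw [circleAverage_eq_circleAverage_zero_one, circleAverage_eq_circleAverage_zero_one (R := r⁻¹),
    ← circleAverage_zero_one_congr_inv (f := fun z => F (↑r⁻¹ * z + 0))]
  simp [mul_comm]

theorem circleAverage_eq_of_differentiableAt {F : ℂ → ℂ} {r R : ℝ} (hr : 0 < r) (hrR : r ≤ R)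
    (hF : ∀ z : ℂ, r ≤ ‖z‖ → ‖z‖ ≤ R → DifferentiableAt ℂ F z) :
    circleAverage F 0 r = circleAverage F 0 R := by
  rw [circleAverage_eq_circleIntegral hr.ne', circleAverage_eq_circleIntegral (hr.trans_le hrR).ne',
    Complex.circleIntegral_sub_center_inv_smul_eq_of_differentiable_on_annulus_off_countable hr hrR
      Set.countable_empty]
  · intro z hz
    simp only [Set.mem_sdiff, Metric.mem_closedBall, dist_zero_right, Metric.mem_ball,
      not_lt] at hz
    exact (hF z hz.2 hz.1).continuousAt.continuousWithinAt
  · intro z hz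
    simp only [Set.mem_sdiff, Metric.mem_closedBall, dist_zero_right, Metric.mem_ball,
      not_le] at hz
    exact hF z hz.1.2.le hz.1.1.le

theorem circleAverage_eq_of_differentiableAt_punctured {F : ℂ → ℂ}
    (hF : ∀ z : ℂ, z ≠ 0 → DifferentiableAt ℂ F z) {r R : ℝ} (hr : 0 < r) (hR : 0 < R) :
    circleAverage F 0 r = circleAverage F 0 R := by
  rcases le_total r R with h | h
  · exact circleAverage_eq_of_differentiableAt hr h fun z hz _ =>
      hF z (norm_pos_iff.1 (hr.trans_le hz))
  · exact (circleAverage_eq_of_differentiableAt hR h fun z hz _ =>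
      hF z (norm_pos_iff.1 (hR.trans_le hz))).symm

/-- A continuous function on the unit circle all of whose Fourier coefficients vanish is zero. -/
theorem eq_zero_of_circleAverage_mul_zpow_eq_zero {F : ℂ → ℂ}
    (hF : ContinuousOn F (Metric.sphere 0 1))
    (h : ∀ k : ℤ, circleAverage (fun z => F z * z ^ k) 0 1 = 0) {z : ℂ} (hz : ‖z‖ = 1) :
    F z = 0 := by
  have : Fact (0 < 2 * π) := ⟨two_pi_pos⟩
  let f : C(AddCircle (2 * π), ℂ) :=
    ⟨fun x => F (AddCircle.toCircle x), hF.comp_continuous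
      (by fun_prop)
      (fun x => by rw [mem_sphere_zero_iff_norm, Circle.norm_coe])⟩
  have hf : ∀ θ : ℝ, f (θ : AddCircle (2 * π)) = F (circleMap 0 1 θ) := by
    intro θ
    have : ((AddCircle.toCircle (θ : AddCircle (2 * π)) : Circle) : ℂ) = circleMap 0 1 θ := by
      rw [AddCircle.toCircle_apply_mk, Circle.coe_exp, circleMap_zero]
      simp
    exact congrArg F this
  have hcoef : ∀ n : ℤ, fourierCoeff f n = 0 := by
    intro n
    rw [fourierCoeff_eq_intervalIntegral f n 0, zero_add, one_div]
    have := h (-n)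
    rw [circleAverage_def] at this
    rw [← this]
    congr 1
    refine intervalIntegral.integral_congr fun θ _ => ?_
    rw [hf, fourier_coe_apply, smul_eq_mul, mul_comm]
    congr 1
    rw [circleMap_zero, Complex.ofReal_one, one_mul, ← Complex.exp_int_mul]
    congr 1
    push_cast
    field_simp
  have hs := has_pointwise_sum_fourier_series_of_summable (f := f)
    (by rw [show fourierCoeff f = fun _ => (0 : ℂ) from funext hcoef]; exact summable_zero)
    (z.arg : AddCircle (2 * π))
  simp only [hcoef, zero_smul] at hs
  have h0 := hs.unique hasSum_zero
  rw [hf] at h0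
  have : circleMap 0 1 z.arg = z := by
    have := Complex.norm_mul_exp_arg_mul_I z
    rw [hz] at this
    simpa [circleMap] using this
  rwa [this] at h0

/-- The average over the unit circle of a function depending holomorphically on a parameter is
holomorphic in the parameter. -/
theorem differentiableOn_circleAverage {F : ℂ → ℂ → ℂ} {U : Set ℂ} (hU : IsOpen U)
    (hc : ContinuousOn (fun x : ℂ × ℂ => F x.1 x.2) (U ×ˢ Metric.sphere 0 1))
    (hd : ∀ z : ℂ, ‖z‖ = 1 → DifferentiableOn ℂ (fun x => F x z) U) :
    DifferentiableOn ℂ (fun x => circleAverage (F x) 0 1) U := by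
  intro x₀ hx₀
  obtain ⟨ε, hε, hεU⟩ := Metric.isOpen_iff.1 hU x₀ hx₀
  have hK : IsCompact (Metric.closedBall x₀ (ε / 2) ×ˢ Metric.sphere (0 : ℂ) 1) :=
    (isCompact_closedBall _ _).prod (isCompact_sphere _ _)
  have hKU : Metric.closedBall x₀ (ε / 2) ⊆ U :=
    (Metric.closedBall_subset_ball (by linarith)).trans hεU
  obtain ⟨C, hC⟩ := hK.exists_bound_of_continuousOn (hc.mono (Set.prod_mono_left hKU))
  have hcθ : ∀ x ∈ U, Continuous fun θ : ℝ => F x (circleMap 0 1 θ) := fun x hx =>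
    hc.comp_continuous (f := fun θ : ℝ => (x, circleMap 0 1 θ)) (by fun_prop)
      (fun θ => ⟨hx, by simp⟩)
  have hdθ : ∀ θ : ℝ, ∀ x ∈ U, HasDerivAt (fun x => F x (circleMap 0 1 θ))
      (deriv (fun x => F x (circleMap 0 1 θ)) x) x := fun θ x hx =>
    ((hd _ (by simp)).differentiableAt (hU.mem_nhds hx)).hasDerivAt
  have hsub : Metric.ball x₀ (ε / 4) ⊆ U :=
    (Metric.ball_subset_ball (by linarith)).trans hεU
  have key := intervalIntegral.hasDerivAt_integral_of_dominated_loc_of_deriv_le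
    (μ := MeasureTheory.volume) (a := 0) (b := 2 * π)
    (F := fun x θ => F x (circleMap 0 1 θ))
    (F' := fun x θ => deriv (fun x => F x (circleMap 0 1 θ)) x) (x₀ := x₀)
    (s := Metric.ball x₀ (ε / 4)) (bound := fun _ => C / (ε / 4))
    (Metric.ball_mem_nhds _ (by linarith))
    (by filter_upwards [hU.mem_nhds hx₀] with x hx using (hcθ x hx).aestronglyMeasurable)
    ((hcθ x₀ hx₀).intervalIntegrable _ _) ?_ ?_ intervalIntegrable_const ?_
  · exact (key.2.const_smul ((2 * π)⁻¹ : ℝ)).differentiableAt.differentiableWithinAt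
  · -- the derivative is a pointwise limit of continuous difference quotients
    obtain ⟨u, hu⟩ := exists_seq_tendsto (𝓝[≠] x₀)
    have hu2 : ∀ᶠ n in atTop, u n ∈ U := hu.eventually
      (eventually_nhdsWithin_of_eventually_nhds (hU.mem_nhds hx₀))
    obtain ⟨N, hN⟩ := eventually_atTop.1 hu2
    have hu3 := hu.comp (tendsto_add_atTop_nat N)
    refine aestronglyMeasurable_of_tendsto_ae (u := atTop)
      (f := fun n θ => slope (fun x => F x (circleMap 0 1 θ)) x₀ (u (n + N))) ?_ ?_
    · intro n
      refine Continuous.aestronglyMeasurable ?_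
      simp only [slope_def_field]
      exact ((hcθ _ (hN _ (by omega))).sub (hcθ _ hx₀)).div_const _
    · exact Eventually.of_forall fun θ =>
        (hasDerivAt_iff_tendsto_slope.1 (hdθ θ x₀ hx₀)).comp hu3
  · refine Eventually.of_forall fun θ _ x hx => ?_
    refine Complex.norm_deriv_le_of_forall_mem_sphere_norm_le (by linarith) ?_ ?_
    · refine DifferentiableOn.diffContOnCl ?_
      refine (hd _ (by simp)).mono ((closure_mono (Metric.ball_subset_closedBall)).trans ?_)
      rw [Metric.isClosed_closedBall.closure_eq]
      refine (Metric.closedBall_subset_closedBall' ?_).trans hKU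
      have := Metric.mem_ball.1 hx
      linarith
    · intro w hw
      refine hC (w, circleMap 0 1 θ) ⟨?_, by simp⟩
      have h1 := Metric.mem_ball.1 hx
      have h2 := Metric.mem_sphere.1 hw
      have := dist_triangle w x x₀
      exact Metric.mem_closedBall.2 (by linarith)
  · exact Eventually.of_forall fun θ _ x hx => hdθ θ x (hsub hx)

end CircleAverage

/-! ### Holomorphic functions on an annulus -/

theorem isOpen_annulus (a b : ℝ) : IsOpen {x : ℂ | a < ‖x‖ ∧ ‖x‖ < b} :=
  (isOpen_lt continuous_const continuous_norm).inter (isOpen_lt continuous_norm continuous_const)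

theorem isPreconnected_annulus {a b : ℝ} (ha : 0 < a) :
    IsPreconnected {x : ℂ | a < ‖x‖ ∧ ‖x‖ < b} := by
  have h : {x : ℂ | a < ‖x‖ ∧ ‖x‖ < b} =
      Complex.exp '' {w : ℂ | Real.log a < w.re ∧ Real.exp w.re < b} := by
    ext x
    constructor
    · rintro ⟨h1, h2⟩
      have h0 : x ≠ 0 := norm_pos_iff.1 (ha.trans h1)
      refine ⟨Complex.log x, ⟨?_, ?_⟩, Complex.exp_log h0⟩
      · rw [Complex.log_re]; exact Real.log_lt_log ha h1
      · rwa [Complex.log_re, Real.exp_log (ha.trans h1)]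
    · rintro ⟨w, ⟨h1, h2⟩, rfl⟩
      rw [Set.mem_ofPred_eq, Complex.norm_exp]
      exact ⟨(Real.log_lt_iff_lt_exp ha).1 h1, h2⟩
  rw [h]
  refine IsPreconnected.image ?_ _ Complex.continuous_exp.continuousOn
  refine Convex.isPreconnected ?_
  have : {w : ℂ | Real.log a < w.re ∧ Real.exp w.re < b} =
      Complex.reLm ⁻¹' (Set.Ioi (Real.log a) ∩ {y | Real.exp y < b}) := by
    ext w; simp
  rw [this]
  refine Convex.linear_preimage (Convex.inter (convex_Ioi _) ?_) _
  refine Set.OrdConnected.convex ⟨fun x _ y hy z hz => ?_⟩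
  exact (Real.exp_le_exp.2 hz.2).trans_lt hy

/-- A holomorphic function on the annulus `a < ‖x‖ < 1` that is invariant under multiplication by
`q` is constant if the annulus contains a fundamental domain: it descends to a holomorphic
function on a compact torus, so its modulus attains a maximum. -/
theorem eq_of_differentiableOn_annulus_of_mul_invariant {a : ℝ} (ha : 0 < a) {q : ℂ}
    (haq : a < ‖q‖) (hq : ‖q‖ < 1) {h : ℂ → ℂ}
    (hd : DifferentiableOn ℂ h {x : ℂ | a < ‖x‖ ∧ ‖x‖ < 1})
    (hinv : ∀ x : ℂ, a < ‖q * x‖ → ‖x‖ < 1 → h (q * x) = h x)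
    {x y : ℂ} (hx : a < ‖x‖ ∧ ‖x‖ < 1) (hy : a < ‖y‖ ∧ ‖y‖ < 1) : h x = h y := by
  have hq0 : 0 < ‖q‖ := ha.trans haq
  obtain ⟨R, hR, hR1⟩ := exists_between (max_lt ((div_lt_one hq0).2 haq) hq)
  have hR2 : a < ‖q‖ * R := by
    have := (le_max_left _ _).trans_lt hR
    rwa [div_lt_iff₀' hq0] at this
  have hR3 : ‖q‖ < R := (le_max_right _ _).trans_lt hR
  set K : Set ℂ := {x : ℂ | ‖q‖ * R ≤ ‖x‖ ∧ ‖x‖ ≤ R} with hKdef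
  have hKA : K ⊆ {x : ℂ | a < ‖x‖ ∧ ‖x‖ < 1} := fun z hz =>
    ⟨hR2.trans_le hz.1, hz.2.trans_lt hR1⟩
  have hKc : IsCompact K := by
    refine Metric.isCompact_of_isClosed_isBounded ?_ ?_
    · exact (isClosed_le continuous_const continuous_norm).inter
        (isClosed_le continuous_norm continuous_const)
    · refine (Metric.isBounded_closedBall (x := (0 : ℂ)) (r := R)).subset fun z hz => ?_
      simpa using hz.2
  have hKne : K.Nonempty := by
    have : 0 < R := hq0.trans hR3
    refine ⟨(R : ℂ), ?_, ?_⟩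
    · rw [Complex.norm_real, Real.norm_of_nonneg this.le]; nlinarith
    · rw [Complex.norm_real, Real.norm_of_nonneg this.le]
  have step : ∀ n : ℕ, ∀ z : ℂ, ‖q‖ ^ (n + 1) * R ≤ ‖z‖ → a < ‖z‖ → ‖z‖ ≤ R →
      ∃ w ∈ K, h w = h z := by
    intro n
    induction n with
    | zero => exact fun z hz _ hz2 => ⟨z, ⟨by simpa using hz, hz2⟩, rfl⟩
    | succ n ih =>
      intro z hz haz hzR
      by_cases hzK : ‖q‖ * R ≤ ‖z‖
      · exact ⟨z, ⟨hzK, hzR⟩, rfl⟩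
      · push Not at hzK
        have e : q * (z / q) = z := mul_div_cancel₀ _ (norm_pos_iff.1 hq0)
        have hn : ‖z / q‖ < R := by rw [norm_div, div_lt_iff₀ hq0]; linarith
        obtain ⟨w, hw, hwz⟩ := ih (z / q)
          (by rw [norm_div, le_div_iff₀ hq0]; calc
                _ = ‖q‖ ^ (n + 1 + 1) * R := by ring
                _ ≤ _ := hz)
          (by rw [norm_div, lt_div_iff₀ hq0]; nlinarith [norm_nonneg z]) hn.le
        refine ⟨w, hw, hwz.trans ?_⟩
        have := hinv (z / q) (by rwa [e]) (hn.trans hR1)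
        rw [e] at this
        exact this.symm
  have hred : ∀ z : ℂ, a < ‖z‖ → ‖z‖ < 1 → ∃ w ∈ K, h w = h z := by
    intro z hz1 hz2
    by_cases hzR : ‖z‖ ≤ R
    · obtain ⟨n, hn⟩ := exists_pow_lt_of_lt_one (ha.trans hz1) hq
      refine step n z ?_ hz1 hzR
      have : ‖q‖ ^ (n + 1) * R ≤ ‖q‖ ^ n := by
        rw [pow_succ, mul_assoc]
        exact mul_le_of_le_one_right (by positivity) (by nlinarith)
      linarith
    · push Not at hzR
      have h1 : ‖q * z‖ = ‖q‖ * ‖z‖ := norm_mul _ _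
      have h2 : ‖q‖ * R ≤ ‖q * z‖ := by rw [h1]; nlinarith
      refine ⟨q * z, ⟨h2, ?_⟩, hinv z (hR2.trans_le h2) hz2⟩
      rw [h1]; nlinarith
  obtain ⟨c, hcK, hc⟩ := hKc.exists_isMaxOn hKne (hd.continuousOn.mono hKA).norm
  have hmax : IsMaxOn (norm ∘ h) {x : ℂ | a < ‖x‖ ∧ ‖x‖ < 1} c := by
    intro z hz
    obtain ⟨w, hw, hwz⟩ := hred z hz.1 hz.2
    have := hc hw
    simpa [← hwz] using this
  have := Complex.eqOn_of_isPreconnected_of_isMaxOn_norm (isPreconnected_annulus ha)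
    (isOpen_annulus a 1) hd (hKA hcK) hmax
  exact (this hx).trans (this hy).symm

/-- The identity theorem on an annulus, for functions known near the inner boundary. -/
theorem eq_const_of_differentiableOn_annulus {a ρ : ℝ} (ha : 0 < a) (haρ : a < ρ) {c : ℂ}
    {h : ℂ → ℂ} (hd : DifferentiableOn ℂ h {x : ℂ | a < ‖x‖ ∧ ‖x‖ < 1})
    (hc : ∀ x : ℂ, a < ‖x‖ → ‖x‖ < 1 → ‖x‖ < ρ → h x = c)
    {x : ℂ} (hx : a < ‖x‖ ∧ ‖x‖ < 1) : h x = c := by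
  obtain ⟨s, hs1, hs2⟩ := exists_between (lt_min (hx.1.trans hx.2) haρ)
  have hs0 : 0 < s := ha.trans hs1
  have hsn : ‖(s : ℂ)‖ = s := by rw [Complex.norm_real, Real.norm_of_nonneg hs0.le]
  have hs3 : (s : ℂ) ∈ {x : ℂ | a < ‖x‖ ∧ ‖x‖ < 1} := by
    rw [Set.mem_ofPred_eq, hsn]; exact ⟨hs1, hs2.trans_le (min_le_left _ _)⟩
  have hA := hd.analyticOnNhd (isOpen_annulus a 1)
  refine hA.eqOn_of_preconnected_of_eventuallyEq (g := fun _ => c) analyticOnNhd_const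
    (isPreconnected_annulus ha) hs3 ?_ hx
  filter_upwards [(isOpen_annulus a (min 1 ρ)).mem_nhds (x := (s : ℂ))
    (by rw [Set.mem_ofPred_eq, hsn]; exact ⟨hs1, hs2⟩)] with z hz
  exact hc z hz.1 (hz.2.trans_le (min_le_left _ _)) (hz.2.trans_le (min_le_right _ _))

/-! ### A theta function identity -/

/-- The odd theta functions of degree six: holomorphic on `ℂ \ {0}`, with `M (1 / z) = -M z` and
`M (p z) = p⁻³ z⁻⁶ M z`. They form a space of dimension two. -/
structure IsOddTheta (p : ℂ) (M : ℂ → ℂ) : Prop where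
  differentiableAt : ∀ z : ℂ, z ≠ 0 → DifferentiableAt ℂ M z
  map_inv : ∀ z : ℂ, z ≠ 0 → M z⁻¹ = -M z
  map_mul : ∀ z : ℂ, z ≠ 0 → M (p * z) = (p ^ 3 * z ^ 6)⁻¹ * M z

namespace IsOddTheta

open Real

variable {p : ℂ} {M N : ℂ → ℂ}

theorem add (hM : IsOddTheta p M) (hN : IsOddTheta p N) : IsOddTheta p fun z => M z + N z where
  differentiableAt z hz := (hM.differentiableAt z hz).add (hN.differentiableAt z hz)
  map_inv z hz := by rw [hM.map_inv z hz, hN.map_inv z hz]; ring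
  map_mul z hz := by rw [hM.map_mul z hz, hN.map_mul z hz]; ring

theorem const_mul (hM : IsOddTheta p M) (c : ℂ) : IsOddTheta p fun z => c * M z where
  differentiableAt z hz := (hM.differentiableAt z hz).const_mul c
  map_inv z hz := by rw [hM.map_inv z hz]; ring
  map_mul z hz := by rw [hM.map_mul z hz]; ring

theorem differentiableAt_mul_zpow (hM : IsOddTheta p M) (k : ℤ) {z : ℂ} (hz : z ≠ 0) :
    DifferentiableAt ℂ (fun z => M z * z ^ k) z :=
  (hM.differentiableAt z hz).mul (differentiableAt_zpow.2 (Or.inl hz))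

theorem circleIntegrable_mul_zpow (hM : IsOddTheta p M) (k : ℤ) :
    CircleIntegrable (fun z => M z * z ^ k) 0 1 := by
  refine ContinuousOn.circleIntegrable zero_le_one fun z hz => ?_
  have hz0 : z ≠ 0 := by rintro rfl; simp at hz
  exact (hM.differentiableAt_mul_zpow k hz0).continuousAt.continuousWithinAt

theorem circleAverage_neg_exponent (hM : IsOddTheta p M) (k : ℤ) :
    circleAverage (fun z => M z * z ^ (-k)) 0 1 = -circleAverage (fun z => M z * z ^ k) 0 1 := by
  rw [← circleAverage_zero_one_congr_inv]
  have : Set.EqOn (fun z : ℂ => M z⁻¹ * z⁻¹ ^ (-k)) ((-1 : ℂ) • fun z => M z * z ^ k)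
      (Metric.sphere 0 |1|) := fun z hz => by
    have hz0 : z ≠ 0 := by rintro rfl; simp at hz
    simp [hM.map_inv z hz0]
  rw [circleAverage_congr_sphere this, circleAverage_smul]
  simp

theorem circleAverage_mul_zpow_sub_six (hM : IsOddTheta p M) (hp0 : p ≠ 0) (k : ℤ) :
    circleAverage (fun z => M z * z ^ k) 0 1 =
      p ^ (k - 3) * circleAverage (fun z => M z * z ^ (k - 6)) 0 1 := by
  rw [circleAverage_eq_of_differentiableAt_punctured
    (fun z hz => hM.differentiableAt_mul_zpow k hz) zero_lt_one
    (show 0 < ‖p‖ * 1 by simpa using hp0), ← circleAverage_comp_mul, ← smul_eq_mul,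
    ← circleAverage_smul]
  refine circleAverage_congr_sphere fun z hz => ?_
  have hz0 : z ≠ 0 := by rintro rfl; simp at hz
  simp only [Pi.smul_apply, smul_eq_mul]
  rw [hM.map_mul z hz0, mul_zpow, zpow_sub₀ hp0, zpow_sub₀ hz0]
  norm_cast
  field_simp

/-- An odd theta function of degree six is determined by two Laurent coefficients. -/
theorem eq_zero (hM : IsOddTheta p M) (hp0 : p ≠ 0)
    (h1 : circleAverage (fun z => M z * z ^ (1 : ℤ)) 0 1 = 0)
    (h2 : circleAverage (fun z => M z * z ^ (2 : ℤ)) 0 1 = 0) {z : ℂ} (hz : z ≠ 0) : M z = 0 := by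
  set c : ℤ → ℂ := fun k => circleAverage (fun z => M z * z ^ k) 0 1 with hc
  have hneg : ∀ k, c (-k) = -c k := hM.circleAverage_neg_exponent
  have hsub : ∀ k, c k = p ^ (k - 3) * c (k - 6) := hM.circleAverage_mul_zpow_sub_six hp0
  have hiff : ∀ k, c k = 0 ↔ c (k - 6) = 0 := fun k => by
    rw [hsub k, mul_eq_zero, or_iff_right (zpow_ne_zero _ hp0)]
  have c0 : c 0 = 0 := by
    have := hneg 0
    rw [neg_zero] at this
    exact self_eq_neg.1 this
  have c3 : c 3 = 0 := by
    have := hsub 3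
    norm_num at this
    rw [hneg 3] at this
    exact self_eq_neg.1 this
  have c4 : c 4 = 0 := (hiff 4).2 (by norm_num; rw [hneg 2, neg_eq_zero]; exact h2)
  have c5 : c 5 = 0 := (hiff 5).2 (by norm_num; rw [hneg 1, neg_eq_zero]; exact h1)
  have hshift : ∀ j : ℤ, c j = 0 → ∀ m : ℤ, c (j + 6 * m) = 0 := by
    intro j hj m
    induction m using Int.induction_on with
    | zero => simpa using hj
    | succ n ih => rw [hiff]; convert ih using 2; ring
    | pred n ih =>
      rw [hiff] at ih
      convert ih using 2; ring
  have hall : ∀ k, c k = 0 := by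
    intro k
    rw [← Int.emod_add_mul_ediv k 6]
    apply hshift
    have l := Int.emod_nonneg k (show (6 : ℤ) ≠ 0 by norm_num)
    have u := Int.emod_lt_of_pos k (show (0 : ℤ) < 6 by norm_num)
    generalize k % 6 = j at l u ⊢
    interval_cases j
    exacts [c0, h1, h2, c3, c4, c5]
  have hr : 0 < ‖z‖ := norm_pos_iff.2 hz
  have hr0 : (‖z‖ : ℂ) ≠ 0 := Complex.ofReal_ne_zero.2 hr.ne'
  have key := eq_zero_of_circleAverage_mul_zpow_eq_zero (F := fun w => M (‖z‖ * w))
    (fun w hw => by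
      have hw0 : w ≠ 0 := by rintro rfl; simp at hw
      have := hM.differentiableAt _ (mul_ne_zero hr0 hw0)
      exact (this.comp w (f := fun w => (‖z‖ : ℂ) * w)
        (by fun_prop)).continuousAt.continuousWithinAt) (fun k => by
      have e : (fun w : ℂ => M (‖z‖ * w) * w ^ k) =
          ((‖z‖ : ℂ) ^ (-k)) • fun w : ℂ => (fun z => M z * z ^ k) (‖z‖ * w) := by
        funext w
        simp only [Pi.smul_apply, smul_eq_mul]
        rw [mul_zpow, zpow_neg]
        field_simp
      rw [e, circleAverage_smul, circleAverage_comp_mul (fun z => M z * z ^ k),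
        circleAverage_eq_of_differentiableAt_punctured
          (fun z hz => hM.differentiableAt_mul_zpow k hz) (R := 1) (by simpa using hz)
          zero_lt_one]
      exact smul_eq_zero_of_right _ (hall k)) (z := z / ‖z‖) (by
      rw [norm_div, Complex.norm_real, norm_norm, div_self hr.ne'])
  rwa [mul_div_cancel₀ _ hr0] at key

theorem exists_linear_relation (hp0 : p ≠ 0) {M : Fin 3 → ℂ → ℂ} (hM : ∀ i, IsOddTheta p (M i)) :
    ∃ c : Fin 3 → ℂ, c ≠ 0 ∧ ∀ z : ℂ, z ≠ 0 → ∑ i, c i * M i z = 0 := by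
  have hdep : ¬ LinearIndependent ℂ (fun i : Fin 3 =>
      (![circleAverage (fun z => M i z * z ^ (1 : ℤ)) 0 1,
        circleAverage (fun z => M i z * z ^ (2 : ℤ)) 0 1] : Fin 2 → ℂ)) := by
    intro h
    have := h.fintype_card_le_finrank
    simp at this
  obtain ⟨c, hc, i, hi⟩ := Fintype.not_linearIndependent_iff.1 hdep
  refine ⟨c, fun h => hi (by rw [h]; rfl), fun z hz => ?_⟩
  have hS : IsOddTheta p fun z => ∑ i, c i * M i z := by
    simp only [Fin.sum_univ_three]
    exact (((hM 0).const_mul _).add ((hM 1).const_mul _)).add ((hM 2).const_mul _)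
  have hav : ∀ k : ℤ, circleAverage (fun z => (∑ i, c i * M i z) * z ^ k) 0 1 =
      ∑ i, c i * circleAverage (fun z => M i z * z ^ k) 0 1 := by
    intro k
    have e : (fun z => (∑ i, c i * M i z) * z ^ k) =
        ∑ i, c i • fun z => M i z * z ^ k := by
      funext z
      simp only [Finset.sum_apply, Pi.smul_apply, smul_eq_mul, Finset.sum_mul, mul_assoc]
    rw [e, circleAverage_sum fun i _ => ((hM i).circleIntegrable_mul_zpow k).const_smul]
    exact Finset.sum_congr rfl fun i _ => circleAverage_smul
  refine hS.eq_zero hp0 ?_ ?_ hz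
  · rw [hav]
    simpa using congrFun hc 0
  · rw [hav]
    simpa using congrFun hc 1

end IsOddTheta

section ThetaIdentity

variable {p : ℂ}

/-- The odd theta function `z⁻¹ θ(z²) θ(t z) θ(t / z)`, vanishing at `z = t`. -/
noncomputable def oddThetaBasis (p t z : ℂ) : ℂ :=
  z⁻¹ * modTheta (z ^ 2) p * (modTheta (t * z) p * modTheta (t * z⁻¹) p)

/-- The product `θ(t z) θ(u z) ∏ θ(s_m z)` of six theta functions. -/
noncomputable def modThetaProd (p t u : ℂ) (s : Fin 4 → ℂ) (z : ℂ) : ℂ :=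
  modTheta (t * z) p * modTheta (u * z) p * ∏ m, modTheta (s m * z) p

theorem differentiableAt_modTheta_mul (hp : ‖p‖ < 1) {t z : ℂ} (ht : t ≠ 0) (hz : z ≠ 0) :
    DifferentiableAt ℂ (fun z => modTheta (t * z) p) z :=
  (differentiableAt_modTheta hp (mul_ne_zero ht hz)).comp z (f := fun z => t * z) (by fun_prop)

theorem modTheta_mul_mul (hp0 : p ≠ 0) (hp : ‖p‖ < 1) {t z : ℂ} (ht : t ≠ 0) (hz : z ≠ 0) :
    modTheta (t * (p * z)) p = -(t * z)⁻¹ * modTheta (t * z) p := by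
  rw [mul_left_comm, modTheta_mul hp0 hp (mul_ne_zero ht hz)]

theorem modTheta_mul_mul_inv (hp0 : p ≠ 0) (hp : ‖p‖ < 1) {t z : ℂ} (ht : t ≠ 0) (hz : z ≠ 0) :
    modTheta (t * (p * z)⁻¹) p = -(t * z⁻¹ / p) * modTheta (t * z⁻¹) p := by
  rw [← modTheta_div hp0 hp (mul_ne_zero ht (inv_ne_zero hz))]
  congr 1
  field_simp

theorem isOddTheta_oddThetaBasis (hp0 : p ≠ 0) (hp : ‖p‖ < 1) {t : ℂ} (ht : t ≠ 0) :
    IsOddTheta p (oddThetaBasis p t) where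
  differentiableAt z hz := by
    have h1 := differentiableAt_modTheta_mul hp ht hz
    have h2 : DifferentiableAt ℂ (fun z => modTheta (t * z⁻¹) p) z :=
      (differentiableAt_modTheta_mul hp ht (inv_ne_zero hz)).comp z (f := fun z => z⁻¹)
        (differentiableAt_inv hz)
    have h3 : DifferentiableAt ℂ (fun z => modTheta (z ^ 2) p) z :=
      (differentiableAt_modTheta hp (pow_ne_zero 2 hz)).comp z (f := fun z => z ^ 2)
        (by fun_prop)
    exact ((differentiableAt_inv hz).mul h3).mul (h1.mul h2)
  map_inv z hz := by
    unfold oddThetaBasis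
    rw [inv_inv, inv_pow, modTheta_inv hp (pow_ne_zero 2 hz)]
    field_simp
  map_mul z hz := by
    unfold oddThetaBasis
    rw [mul_pow, modTheta_sq_mul hp0 hp (pow_ne_zero 2 hz), modTheta_mul_mul hp0 hp ht hz,
      modTheta_mul_mul_inv hp0 hp ht hz]
    field_simp

theorem isOddTheta_modThetaProd_sub (hp0 : p ≠ 0) (hp : ‖p‖ < 1) {t u : ℂ} {s : Fin 4 → ℂ}
    (h : t * u * ∏ m, s m = p) :
    IsOddTheta p fun z => (z ^ 2)⁻¹ * modThetaProd p t u s z - z ^ 2 * modThetaProd p t u s z⁻¹ := by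
  have hne := h ▸ hp0
  have ht := left_ne_zero_of_mul (left_ne_zero_of_mul hne)
  have hu := right_ne_zero_of_mul (left_ne_zero_of_mul hne)
  have hs : ∀ m, s m ≠ 0 := fun m =>
    Finset.prod_ne_zero_iff.1 (right_ne_zero_of_mul hne) m (Finset.mem_univ m)
  have hd : ∀ z : ℂ, z ≠ 0 → DifferentiableAt ℂ (modThetaProd p t u s) z := fun z hz =>
    ((differentiableAt_modTheta_mul hp ht hz).mul (differentiableAt_modTheta_mul hp hu hz)).mul
      (DifferentiableAt.fun_finsetProd fun m _ => differentiableAt_modTheta_mul hp (hs m) hz)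
  have h1 : ∀ z : ℂ, z ≠ 0 →
      modThetaProd p t u s (p * z) = (p * z ^ 6)⁻¹ * modThetaProd p t u s z := by
    intro z hz
    unfold modThetaProd
    simp only [modTheta_mul_mul hp0 hp ht hz, modTheta_mul_mul hp0 hp hu hz,
      modTheta_mul_mul hp0 hp (hs _) hz, Finset.prod_mul_distrib]
    have e : ∏ m, -(s m * z)⁻¹ = (z ^ 4 * ∏ m, s m)⁻¹ := by
      simp only [Fin.prod_univ_four, mul_inv]; ring
    rw [e]
    have e2 : (p * z ^ 6)⁻¹ = (t * u * (∏ m, s m) * z ^ 6)⁻¹ := by rw [h]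
    rw [e2]
    simp only [mul_inv]
    ring
  have h2 : ∀ z : ℂ, z ≠ 0 →
      modThetaProd p t u s (p * z)⁻¹ = (p ^ 5 * z ^ 6)⁻¹ * modThetaProd p t u s z⁻¹ := by
    intro z hz
    unfold modThetaProd
    simp only [modTheta_mul_mul_inv hp0 hp ht hz, modTheta_mul_mul_inv hp0 hp hu hz,
      modTheta_mul_mul_inv hp0 hp (hs _) hz, Finset.prod_mul_distrib]
    have e : ∏ m, -(s m * z⁻¹ / p) = (∏ m, s m) * (z ^ 4 * p ^ 4)⁻¹ := by
      simp only [Fin.prod_univ_four, mul_inv]; ring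
    rw [e]
    have e2 : (p ^ 5 * z ^ 6)⁻¹ = (t * u * ∏ m, s m) * (p ^ 6 * z ^ 6)⁻¹ := by
      rw [h]; field_simp
    rw [e2]
    simp only [mul_inv]
    ring
  refine ⟨fun z hz => ?_, fun z hz => ?_, fun z hz => ?_⟩
  · have h3 : DifferentiableAt ℂ (fun z => modThetaProd p t u s z⁻¹) z :=
      (hd _ (inv_ne_zero hz)).comp z (f := fun z => z⁻¹) (differentiableAt_inv hz)
    have h4 : DifferentiableAt ℂ (fun z : ℂ => (z ^ 2)⁻¹) z := by
      fun_prop (disch := exact pow_ne_zero 2 hz)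
    exact (h4.mul (hd z hz)).sub ((differentiableAt_pow 2).mul h3)
  · rw [inv_inv, inv_pow, inv_inv]; ring
  · rw [h1 z hz, h2 z hz]
    field_simp

/-- Expansion of an odd theta function of degree six in the basis of those vanishing at `t`
and at `u`. -/
theorem modThetaProd_sub_eq (hp0 : p ≠ 0) (hp : ‖p‖ < 1) {t u : ℂ} {s : Fin 4 → ℂ}
    (h : t * u * ∏ m, s m = p) (ht2 : modTheta (t ^ 2) p ≠ 0) (hu2 : modTheta (u ^ 2) p ≠ 0)
    (htu : modTheta (t * u) p ≠ 0) (hut : modTheta (u * t⁻¹) p ≠ 0) {z : ℂ} (hz : z ≠ 0) :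
    t * modTheta (u * t⁻¹) p *
        ((z ^ 2)⁻¹ * modThetaProd p t u s z - z ^ 2 * modThetaProd p t u s z⁻¹) =
      (∏ m, modTheta (s m * t) p) * oddThetaBasis p u z -
        (∏ m, modTheta (s m * u) p) * oddThetaBasis p t z := by
  have hne := h ▸ hp0
  have ht := left_ne_zero_of_mul (left_ne_zero_of_mul hne)
  have hu := right_ne_zero_of_mul (left_ne_zero_of_mul hne)
  have htu' : modTheta (t * u⁻¹) p = -(t * u⁻¹) * modTheta (u * t⁻¹) p := by
    have := modTheta_inv hp (mul_ne_zero hu (inv_ne_zero ht))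
    rwa [mul_inv, inv_inv, mul_comm u⁻¹] at this
  set D : ℂ → ℂ := fun z => t * modTheta (u * t⁻¹) p *
        ((z ^ 2)⁻¹ * modThetaProd p t u s z - z ^ 2 * modThetaProd p t u s z⁻¹) +
      (-(∏ m, modTheta (s m * t) p) * oddThetaBasis p u z +
        (∏ m, modTheta (s m * u) p) * oddThetaBasis p t z) with hD
  have hDodd : IsOddTheta p D :=
    ((isOddTheta_modThetaProd_sub hp0 hp h).const_mul _).add
      (((isOddTheta_oddThetaBasis hp0 hp hu).const_mul _).add
        ((isOddTheta_oddThetaBasis hp0 hp ht).const_mul _))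
  have htt : oddThetaBasis p t t = 0 := by
    simp [oddThetaBasis, mul_inv_cancel₀ ht, modTheta_one hp]
  have huu : oddThetaBasis p u u = 0 := by
    simp [oddThetaBasis, mul_inv_cancel₀ hu, modTheta_one hp]
  have hEu : oddThetaBasis p u t ≠ 0 := by
    unfold oddThetaBasis
    rw [mul_comm u t]
    exact mul_ne_zero (mul_ne_zero (inv_ne_zero ht) ht2) (mul_ne_zero htu hut)
  have hEt : oddThetaBasis p t u ≠ 0 := by
    unfold oddThetaBasis
    rw [htu']
    exact mul_ne_zero (mul_ne_zero (inv_ne_zero hu) hu2) (mul_ne_zero htu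
      (mul_ne_zero (neg_ne_zero.2 (mul_ne_zero ht (inv_ne_zero hu))) hut))
  have hDt : D t = 0 := by
    simp only [hD, htt]
    simp only [modThetaProd, oddThetaBasis, mul_inv_cancel₀ ht, modTheta_one hp, ← pow_two]
    field_simp
    ring
  have hDu : D u = 0 := by
    simp only [hD, huu]
    simp only [modThetaProd, oddThetaBasis, mul_inv_cancel₀ hu, modTheta_one hp, ← pow_two, htu']
    field_simp
    ring
  obtain ⟨c, hc, hrel⟩ := IsOddTheta.exists_linear_relation hp0
    (M := ![D, oddThetaBasis p t, oddThetaBasis p u]) (by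
      intro i
      fin_cases i
      exacts [hDodd, isOddTheta_oddThetaBasis hp0 hp ht, isOddTheta_oddThetaBasis hp0 hp hu])
  simp only [Fin.sum_univ_three, Matrix.cons_val_zero, Matrix.cons_val_one,
    Matrix.cons_val] at hrel
  have c2 : c 2 = 0 := by
    have := hrel t ht
    rw [hDt, htt] at this
    simpa [hEu] using this
  have c1 : c 1 = 0 := by
    have := hrel u hu
    rw [hDu, huu] at this
    simpa [hEt] using this
  have c0 : c 0 ≠ 0 := fun c0 => hc (by
    funext i
    fin_cases i
    exacts [c0, c1, c2])
  have hDz : D z = 0 := by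
    have := hrel z hz
    rw [c1, c2] at this
    simpa [c0] using this
  simp only [hD] at hDz
  linear_combination hDz

end ThetaIdentity

open Matrix

/-! ### The integral as a circle average -/

/-- The integrand of the elliptic beta integral with respect to `dz / z`, with `1 / Γ(z^{±2}; p, q)`
written as the product of theta functions `θ(z²; p) θ(z⁻²; q)`, which is continuous also at
`z = ±1`. -/
noncomputable def betaWeight (p q : ℂ) (t : Fin 6 → ℂ) (z : ℂ) : ℂ :=
  (∏ j, ellipticGamma (t j * z) p q * ellipticGamma (t j * z⁻¹) p q) *
    (modTheta (z ^ 2) p * modTheta (z ^ 2)⁻¹ q)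

/-- The mean value of `betaWeight` over the unit circle. -/
noncomputable def betaMean (p q : ℂ) (t : Fin 6 → ℂ) : ℂ :=
  Real.circleAverage (betaWeight p q t) 0 1

/-- The product `∏_{j < k} Γ(t_j t_k; p, q)`. -/
noncomputable def betaProd (p q : ℂ) (t : Fin 6 → ℂ) : ℂ :=
  ∏ j, ∏ k ∈ Finset.Ioi j, ellipticGamma (t j * t k) p q

/-- The parameters of the elliptic beta integral: six points of the open unit disc subject to the
balancing condition. -/
structure IsBalanced (p q : ℂ) (t : Fin 6 → ℂ) : Prop where
  norm_lt_one : ∀ j, ‖t j‖ < 1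
  prod_eq : ∏ j, t j = p * q

section

variable {p q : ℂ}

theorem IsBalanced.ne_zero {t : Fin 6 → ℂ} (ht : IsBalanced p q t) (hp0 : p ≠ 0) (hq0 : q ≠ 0)
    (j : Fin 6) : t j ≠ 0 :=
  Finset.prod_ne_zero_iff.1 (ht.prod_eq ▸ mul_ne_zero hp0 hq0) j (Finset.mem_univ j)

theorem norm_prod_lt_one {n : ℕ} {s : Fin n → ℂ} (hs : ∀ m, ‖s m‖ < 1) (S : Finset (Fin n))
    (hS : S.Nonempty) : ‖∏ m ∈ S, s m‖ < 1 := by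
  obtain ⟨m, hm⟩ := hS
  rw [← Finset.mul_prod_erase S s hm, norm_mul, norm_prod]
  refine mul_lt_one_of_nonneg_of_lt_one_left (norm_nonneg _) (hs m) ?_
  exact Finset.prod_le_one (fun _ _ => norm_nonneg _) fun i _ => (hs i).le

/-- The factors `Γ(t_j t_k; p, q)` do not vanish: `p q / (t_j t_k)` is the product of the other four
parameters, so it lies in the open unit disc. -/
theorem IsBalanced.betaProd_ne_zero {t : Fin 6 → ℂ} (ht : IsBalanced p q t) (hp0 : p ≠ 0)
    (hq0 : q ≠ 0) (hp : ‖p‖ < 1) (hq : ‖q‖ < 1) : betaProd p q t ≠ 0 := by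
  refine Finset.prod_ne_zero_iff.2 fun j _ => Finset.prod_ne_zero_iff.2 fun k hk => ?_
  have hjk : j ≠ k := (Finset.mem_Ioi.1 hk).ne
  have hpair : ∏ i ∈ ({j, k} : Finset (Fin 6)), t i = t j * t k := Finset.prod_pair hjk
  refine ellipticGamma_ne_zero hp hq ?_ ?_
  · rw [← hpair]
    exact norm_prod_lt_one ht.norm_lt_one _ ⟨j, by simp⟩
  · rw [← ht.prod_eq, ← Finset.prod_mul_prod_compl {j, k}, hpair,
      mul_div_cancel_left₀ _ (mul_ne_zero (ht.ne_zero hp0 hq0 j) (ht.ne_zero hp0 hq0 k))]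
    refine norm_prod_lt_one ht.norm_lt_one _ (Finset.card_pos.1 ?_)
    rw [Finset.card_compl, Finset.card_pair hjk]
    simp

theorem norm_mul_lt_one_of_norm_eq_one {x z : ℂ} (hx : ‖x‖ < 1) (hz : ‖z‖ = 1) : ‖x * z‖ < 1 := by
  rwa [norm_mul, hz, mul_one]

theorem differentiableAt_ellipticGamma_comp (hp : ‖p‖ < 1) (hq : ‖q‖ < 1) {f : ℂ → ℂ} {x : ℂ}
    (hf : DifferentiableAt ℂ f x) (h0 : f x ≠ 0) (h1 : ‖f x‖ < 1) :
    DifferentiableAt ℂ (fun x => ellipticGamma (f x) p q) x :=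
  (differentiableAt_ellipticGamma hp hq h0 h1).comp x hf

theorem differentiableAt_modTheta_comp (hp : ‖p‖ < 1) {f : ℂ → ℂ} {x : ℂ}
    (hf : DifferentiableAt ℂ f x) (h0 : f x ≠ 0) :
    DifferentiableAt ℂ (fun x => modTheta (f x) p) x :=
  (differentiableAt_modTheta hp h0).comp x hf

theorem continuousOn_betaWeight (hp : ‖p‖ < 1) (hq : ‖q‖ < 1) :
    ContinuousOn (fun x : (Fin 6 → ℂ) × ℂ => betaWeight p q x.1 x.2)
      {x | (∀ j, x.1 j ≠ 0 ∧ ‖x.1 j‖ < 1) ∧ ‖x.2‖ = 1} := by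
  rintro ⟨t, z⟩ ⟨ht, hz⟩
  have hz0 : z ≠ 0 := by rintro rfl; simp at hz
  have hz' : ‖z⁻¹‖ = 1 := by rw [norm_inv, hz, inv_one]
  refine ContinuousAt.continuousWithinAt ?_
  have hj : ∀ j, ContinuousAt (fun x : (Fin 6 → ℂ) × ℂ => x.1 j) (t, z) := fun j => by fun_prop
  have hzc : ContinuousAt (fun x : (Fin 6 → ℂ) × ℂ => x.2) (t, z) := continuousAt_snd
  have hzi : ContinuousAt (fun x : (Fin 6 → ℂ) × ℂ => x.2⁻¹) (t, z) := hzc.inv₀ hz0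
  refine ContinuousAt.mul (tendsto_finsetProd _ fun j _ => ContinuousAt.mul ?_ ?_)
    (ContinuousAt.mul ?_ ?_)
  · exact (differentiableAt_ellipticGamma hp hq (mul_ne_zero (ht j).1 hz0)
      (norm_mul_lt_one_of_norm_eq_one (ht j).2 hz)).continuousAt.comp_of_eq ((hj j).mul hzc) rfl
  · exact (differentiableAt_ellipticGamma hp hq (mul_ne_zero (ht j).1 (inv_ne_zero hz0))
      (norm_mul_lt_one_of_norm_eq_one (ht j).2 hz')).continuousAt.comp_of_eq ((hj j).mul hzi) rfl
  · exact (differentiableAt_modTheta hp (pow_ne_zero 2 hz0)).continuousAt.comp_of_eq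
      (hzc.pow 2) rfl
  · exact (differentiableAt_modTheta hq (inv_ne_zero (pow_ne_zero 2 hz0))).continuousAt.comp_of_eq
      ((hzc.pow 2).inv₀ (pow_ne_zero 2 hz0)) rfl

theorem continuousOn_betaWeight_sphere (hp : ‖p‖ < 1) (hq : ‖q‖ < 1) {t : Fin 6 → ℂ}
    (ht : ∀ j, t j ≠ 0 ∧ ‖t j‖ < 1) : ContinuousOn (betaWeight p q t) (Metric.sphere 0 1) :=
  (continuousOn_betaWeight hp hq).comp (f := fun z => (t, z)) (by fun_prop)
    fun z hz => ⟨ht, by simpa using hz⟩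

/-- `betaMean / betaProd` depends holomorphically on the parameters. -/
theorem differentiableOn_betaMean_div_betaProd (hp0 : p ≠ 0) (hq0 : q ≠ 0) (hp : ‖p‖ < 1)
    (hq : ‖q‖ < 1) {U : Set ℂ} (hU : IsOpen U) {t : ℂ → Fin 6 → ℂ}
    (ht : ∀ x ∈ U, IsBalanced p q (t x)) (hd : ∀ j, DifferentiableOn ℂ (fun x => t x j) U) :
    DifferentiableOn ℂ (fun x => betaMean p q (t x) / betaProd p q (t x)) U := by
  refine DifferentiableOn.div ?_ ?_ fun x hx => (ht x hx).betaProd_ne_zero hp0 hq0 hp hq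
  · refine differentiableOn_circleAverage hU ?_ ?_
    · refine (continuousOn_betaWeight hp hq).comp
        (f := fun x : ℂ × ℂ => (t x.1, x.2)) ?_ ?_
      · refine ContinuousOn.prodMk ?_ continuousOn_snd
        exact continuousOn_pi.2 fun j => (hd j).continuousOn.comp continuousOn_fst fun x hx => hx.1
      · rintro ⟨x, z⟩ ⟨hx, hz⟩
        exact ⟨fun j => ⟨(ht x hx).ne_zero hp0 hq0 j, (ht x hx).norm_lt_one j⟩, by simpa using hz⟩
    · intro z hz x hx
      have hz0 : z ≠ 0 := by rintro rfl; simp at hz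
      have hz' : ‖z⁻¹‖ = 1 := by rw [norm_inv, hz, inv_one]
      refine DifferentiableAt.differentiableWithinAt ?_
      refine DifferentiableAt.mul_const (DifferentiableAt.fun_finsetProd fun j _ =>
        DifferentiableAt.mul ?_ ?_) _
      · exact differentiableAt_ellipticGamma_comp hp hq
          (((hd j).differentiableAt (hU.mem_nhds hx)).mul_const z)
          (mul_ne_zero ((ht x hx).ne_zero hp0 hq0 j) hz0)
          (norm_mul_lt_one_of_norm_eq_one ((ht x hx).norm_lt_one j) hz)
      · exact differentiableAt_ellipticGamma_comp hp hq
          (((hd j).differentiableAt (hU.mem_nhds hx)).mul_const z⁻¹)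
          (mul_ne_zero ((ht x hx).ne_zero hp0 hq0 j) (inv_ne_zero hz0))
          (norm_mul_lt_one_of_norm_eq_one ((ht x hx).norm_lt_one j) hz')
  · intro x hx
    refine DifferentiableAt.differentiableWithinAt ?_
    refine DifferentiableAt.fun_finsetProd fun j _ => DifferentiableAt.fun_finsetProd fun k _ => ?_
    refine differentiableAt_ellipticGamma_comp hp hq
      (((hd j).differentiableAt (hU.mem_nhds hx)).mul ((hd k).differentiableAt (hU.mem_nhds hx)))
      (mul_ne_zero ((ht x hx).ne_zero hp0 hq0 j) ((ht x hx).ne_zero hp0 hq0 k)) ?_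
    rw [norm_mul]
    exact mul_lt_one_of_nonneg_of_lt_one_left (norm_nonneg _) ((ht x hx).norm_lt_one j)
      ((ht x hx).norm_lt_one k).le

end

/-! ### The difference equation -/

section Shift

variable {p q : ℂ}

theorem prod_vecCons_vecCons {M : Type*} [CommMonoid M] (f : ℂ → M) (t u : ℂ) (s : Fin 4 → ℂ) :
    ∏ j, f (vecCons t (vecCons u s) j) = f t * f u * ∏ m, f (s m) := by
  rw [Fin.prod_univ_succ, Fin.prod_univ_succ, mul_assoc]
  simp

theorem isBalanced_vecCons {t u : ℂ} {s : Fin 4 → ℂ} (ht : ‖t‖ < 1) (hu : ‖u‖ < 1)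
    (hs : ∀ m, ‖s m‖ < 1) (h : t * u * ∏ m, s m = p * q) :
    IsBalanced p q (vecCons t (vecCons u s)) where
  norm_lt_one j := by
    refine Fin.cases ht (fun j => ?_) j
    exact Fin.cases hu hs j
  prod_eq := (prod_vecCons_vecCons id t u s).trans h

theorem betaProd_vecCons (t u : ℂ) (s : Fin 4 → ℂ) :
    betaProd p q (vecCons t (vecCons u s)) =
      ellipticGamma (t * u) p q * (∏ m, ellipticGamma (t * s m) p q) *
        (∏ m, ellipticGamma (u * s m) p q) *
        ∏ m, ∏ n ∈ Finset.Ioi m, ellipticGamma (s m * s n) p q := by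
  unfold betaProd
  rw [Fin.prod_univ_succ, Fin.prod_univ_succ, Fin.prod_Ioi_zero, Fin.prod_univ_succ]
  simp only [Fin.prod_Ioi_succ, Fin.prod_Ioi_zero, cons_val_zero, cons_val_succ, mul_assoc]

theorem betaProd_shift (hp : ‖p‖ < 1) (hq0 : q ≠ 0) (hq : ‖q‖ < 1) {t u : ℂ} {s : Fin 4 → ℂ}
    (ht : ‖t‖ < 1) (hu : ‖u‖ < 1) (hs : ∀ m, ‖s m‖ < 1) :
    betaProd p q (vecCons (q * t) (vecCons u s)) * ∏ m, modTheta (s m * u) p =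
      betaProd p q (vecCons t (vecCons (q * u) s)) * ∏ m, modTheta (s m * t) p := by
  have h : ∀ x : ℂ, ‖x‖ < 1 → ∏ m, ellipticGamma (q * x * s m) p q =
      (∏ m, modTheta (s m * x) p) * ∏ m, ellipticGamma (x * s m) p q := by
    intro x hx
    rw [← Finset.prod_mul_distrib]
    refine Finset.prod_congr rfl fun m _ => ?_
    rw [mul_assoc, ellipticGamma_mul_right hp hq0 hq, mul_comm x]
    rw [norm_mul]
    exact mul_lt_one_of_nonneg_of_lt_one_left (norm_nonneg _) hx (hs m).le
  rw [betaProd_vecCons, betaProd_vecCons, h t ht, h u hu, mul_left_comm t q u, mul_assoc q t u]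
  ring

/-- The integrand `z⁻¹ ∏ Γ(q x_i z) Γ(x_i / z) θ(z⁻²; q)`, which is odd under `z ↦ 1 / (q z)`, has
mean value zero over the unit circle: it is holomorphic for `1 ≤ |z| ≤ |q|^{-1/2}`, and the
circle `|z| = |q|^{-1/2}` is invariant under that involution. -/
theorem circleAverage_ellipticGamma_eq_zero (hp : ‖p‖ < 1) (hq0 : q ≠ 0) (hq : ‖q‖ < 1)
    {x : Fin 6 → ℂ} (hx0 : ∀ i, x i ≠ 0) (hx : ∀ i, ‖x i‖ < 1) :
    Real.circleAverage (fun z => z⁻¹ * modTheta (z ^ 2)⁻¹ q *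
      ∏ i, ellipticGamma (q * (x i * z)) p q * ellipticGamma (x i * z⁻¹) p q) 0 1 = 0 := by
  set g : ℂ → ℂ := fun z => z⁻¹ * modTheta (z ^ 2)⁻¹ q *
      ∏ i, ellipticGamma (q * (x i * z)) p q * ellipticGamma (x i * z⁻¹) p q with hg
  have hqn : 0 < ‖q‖ := norm_pos_iff.2 hq0
  obtain ⟨σ, hs0, hsq⟩ : ∃ σ : ℝ, 0 < σ ∧ σ * σ = ‖q‖ :=
    ⟨√‖q‖, Real.sqrt_pos.2 hqn, Real.mul_self_sqrt hqn.le⟩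
  set r : ℝ := σ⁻¹ with hr
  have hs1 : σ ≤ 1 := by nlinarith
  have hr1 : 1 ≤ r := (one_le_inv₀ hs0).2 hs1
  have hd : ∀ z : ℂ, 1 ≤ ‖z‖ → ‖z‖ ≤ r → DifferentiableAt ℂ g z := by
    intro z hz1 hzr
    have hz0 : z ≠ 0 := norm_pos_iff.1 (zero_lt_one.trans_le hz1)
    have hqz : ‖q‖ * ‖z‖ ≤ 1 := by
      calc ‖q‖ * ‖z‖ ≤ ‖q‖ * r := by gcongr
        _ = σ := by rw [← hsq, hr]; field_simp
        _ ≤ 1 := hs1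
    refine DifferentiableAt.mul (DifferentiableAt.mul (differentiableAt_inv hz0) ?_)
      (DifferentiableAt.fun_finsetProd fun i _ => DifferentiableAt.mul ?_ ?_)
    · exact differentiableAt_modTheta_comp hq
        (by fun_prop (disch := exact pow_ne_zero 2 hz0)) (inv_ne_zero (pow_ne_zero 2 hz0))
    · refine differentiableAt_ellipticGamma_comp hp hq (by fun_prop)
        (mul_ne_zero hq0 (mul_ne_zero (hx0 i) hz0)) ?_
      rw [norm_mul, norm_mul, mul_left_comm]
      exact mul_lt_one_of_nonneg_of_lt_one_left (norm_nonneg _) (hx i) hqz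
    · refine differentiableAt_ellipticGamma_comp hp hq (by fun_prop (disch := exact hz0))
        (mul_ne_zero (hx0 i) (inv_ne_zero hz0)) ?_
      rw [norm_mul, norm_inv]
      exact mul_lt_one_of_nonneg_of_lt_one_left (by positivity) (hx i) (inv_le_one_of_one_le₀ hz1)
  rw [circleAverage_eq_of_differentiableAt zero_lt_one hr1 hd]
  have hrr : ‖q⁻¹‖ * r⁻¹ = r := by
    rw [hr, inv_inv, norm_inv, ← hsq]
    field_simp
  have hanti : Real.circleAverage (fun z => g (q⁻¹ * z⁻¹)) 0 r = Real.circleAverage g 0 r := by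
    rw [circleAverage_comp_inv (fun z => g (q⁻¹ * z)), circleAverage_comp_mul, hrr]
  have hodd : Set.EqOn (fun z => g (q⁻¹ * z⁻¹)) ((-1 : ℂ) • g) (Metric.sphere 0 |r|) := by
    intro z hz
    have hz0 : z ≠ 0 := by
      rintro rfl
      have : 0 = |r| := by simpa using hz
      rw [abs_of_pos (by linarith)] at this
      linarith
    have e1 : ((q⁻¹ * z⁻¹) ^ 2)⁻¹ = q ^ 2 * z ^ 2 := by rw [mul_pow, mul_inv]; simp
    have e2 : ∀ i, q * (x i * (q⁻¹ * z⁻¹)) = x i * z⁻¹ := fun i => by field_simp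
    have e3 : ∀ i, x i * (q⁻¹ * z⁻¹)⁻¹ = q * (x i * z) := fun i => by field_simp
    simp only [hg, Pi.smul_apply, smul_eq_mul, e1, e2, e3]
    rw [modTheta_sq_mul hq0 hq (pow_ne_zero 2 hz0), modTheta_inv hq (pow_ne_zero 2 hz0)]
    simp only [mul_comm (ellipticGamma (x _ * z⁻¹) p q)]
    field_simp
  rw [Real.circleAverage_congr_sphere hodd, Real.circleAverage_smul, smul_eq_mul, neg_one_mul]
    at hanti
  exact neg_eq_self.1 hanti

/-- The difference equation for the integral, for generic `t` and `u`. -/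
theorem betaMean_shift (hp0 : p ≠ 0) (hq0 : q ≠ 0) (hp : ‖p‖ < 1) (hq : ‖q‖ < 1) {t u : ℂ}
    {s : Fin 4 → ℂ} (ht : ‖t‖ < 1) (hu : ‖u‖ < 1) (hs : ∀ m, ‖s m‖ < 1)
    (h : t * u * ∏ m, s m = p) (ht2 : modTheta (t ^ 2) p ≠ 0) (hu2 : modTheta (u ^ 2) p ≠ 0)
    (htu : modTheta (t * u) p ≠ 0) (hut : modTheta (u * t⁻¹) p ≠ 0) :
    (∏ m, modTheta (s m * t) p) * betaMean p q (vecCons t (vecCons (q * u) s)) =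
      (∏ m, modTheta (s m * u) p) * betaMean p q (vecCons (q * t) (vecCons u s)) := by
  have hne := h ▸ hp0
  have ht0 := left_ne_zero_of_mul (left_ne_zero_of_mul hne)
  have hu0 := right_ne_zero_of_mul (left_ne_zero_of_mul hne)
  have hs0 : ∀ m, s m ≠ 0 := fun m =>
    Finset.prod_ne_zero_iff.1 (right_ne_zero_of_mul hne) m (Finset.mem_univ m)
  set x : Fin 6 → ℂ := vecCons t (vecCons u s) with hx
  have hx0 : ∀ i, x i ≠ 0 := fun i => Fin.cases ht0 (fun j => Fin.cases hu0 hs0 j) i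
  have hx1 : ∀ i, ‖x i‖ < 1 := fun i => Fin.cases ht (fun j => Fin.cases hu hs j) i
  set g : ℂ → ℂ := fun z => z⁻¹ * modTheta (z ^ 2)⁻¹ q *
      ∏ i, ellipticGamma (q * (x i * z)) p q * ellipticGamma (x i * z⁻¹) p q with hg
  have hg0 : Real.circleAverage g 0 1 = 0 :=
    circleAverage_ellipticGamma_eq_zero hp hq0 hq hx0 hx1
  have hgc : ContinuousOn g (Metric.sphere 0 1) := by
    intro z hz
    have hz1 : ‖z‖ = 1 := by simpa using hz
    have hz0 : z ≠ 0 := by rintro rfl; simp at hz1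
    refine ContinuousAt.continuousWithinAt (DifferentiableAt.continuousAt (𝕜 := ℂ) ?_)
    refine DifferentiableAt.mul (DifferentiableAt.mul (differentiableAt_inv hz0) ?_)
      (DifferentiableAt.fun_finsetProd fun i _ => DifferentiableAt.mul ?_ ?_)
    · exact differentiableAt_modTheta_comp hq
        (by fun_prop (disch := exact pow_ne_zero 2 hz0)) (inv_ne_zero (pow_ne_zero 2 hz0))
    · refine differentiableAt_ellipticGamma_comp hp hq (by fun_prop)
        (mul_ne_zero hq0 (mul_ne_zero (hx0 i) hz0)) ?_
      rw [norm_mul]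
      exact mul_lt_one_of_nonneg_of_lt_one_left (norm_nonneg _) hq
        (norm_mul_lt_one_of_norm_eq_one (hx1 i) hz1).le
    · exact differentiableAt_ellipticGamma_comp hp hq (by fun_prop (disch := exact hz0))
        (mul_ne_zero (hx0 i) (inv_ne_zero hz0))
        (norm_mul_lt_one_of_norm_eq_one (hx1 i) (by rw [norm_inv, hz1, inv_one]))
  have hgi : CircleIntegrable g 0 1 := hgc.circleIntegrable zero_le_one
  have hgi' : CircleIntegrable (fun z => g z⁻¹) 0 1 := by
    refine ContinuousOn.circleIntegrable zero_le_one (hgc.comp (f := fun z => z⁻¹) ?_ ?_)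
    · intro z hz
      have hz0 : z ≠ 0 := by rintro rfl; simp at hz
      exact (continuousAt_inv₀ hz0).continuousWithinAt
    · intro z hz
      simpa using hz
  have hW1 : CircleIntegrable (betaWeight p q (vecCons t (vecCons (q * u) s))) 0 1 := by
    refine (continuousOn_betaWeight_sphere hp hq fun j => ?_).circleIntegrable zero_le_one
    refine Fin.cases ⟨ht0, ht⟩ (fun j => Fin.cases ⟨mul_ne_zero hq0 hu0, ?_⟩
      (fun m => ⟨hs0 m, hs m⟩) j) j
    rw [cons_val_succ, cons_val_zero, norm_mul]
    exact mul_lt_one_of_nonneg_of_lt_one_left (norm_nonneg _) hq hu.le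
  have hW2 : CircleIntegrable (betaWeight p q (vecCons (q * t) (vecCons u s))) 0 1 := by
    refine (continuousOn_betaWeight_sphere hp hq fun j => ?_).circleIntegrable zero_le_one
    refine Fin.cases ⟨mul_ne_zero hq0 ht0, ?_⟩ (fun j => Fin.cases ⟨hu0, hu⟩
      (fun m => ⟨hs0 m, hs m⟩) j) j
    rw [cons_val_zero, norm_mul]
    exact mul_lt_one_of_nonneg_of_lt_one_left (norm_nonneg _) hq ht.le
  have key : Set.EqOn (((t * modTheta (u * t⁻¹) p) • g) + (t * modTheta (u * t⁻¹) p) •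
        fun z => g z⁻¹)
      ((∏ m, modTheta (s m * t) p) • betaWeight p q (vecCons t (vecCons (q * u) s)) -
        (∏ m, modTheta (s m * u) p) • betaWeight p q (vecCons (q * t) (vecCons u s)))
      (Metric.sphere 0 |1|) := by
    intro z hz
    have hz1 : ‖z‖ = 1 := by simpa using hz
    have hz0 : z ≠ 0 := by rintro rfl; simp at hz1
    have hz1' : ‖z⁻¹‖ = 1 := by rw [norm_inv, hz1, inv_one]
    have hK := modThetaProd_sub_eq hp0 hp h ht2 hu2 htu hut hz0
    have hG : ∀ y w : ℂ, ‖y‖ < 1 → ‖w‖ = 1 → ellipticGamma (q * (y * w)) p q =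
        modTheta (y * w) p * ellipticGamma (y * w) p q := fun y w hy hw =>
      ellipticGamma_mul_right hp hq0 hq (norm_mul_lt_one_of_norm_eq_one hy hw)
    have hprod : ∀ w : ℂ, ‖w‖ = 1 →
        ∏ i, ellipticGamma (q * (x i * w)) p q * ellipticGamma (x i * w⁻¹) p q =
          modThetaProd p t u s w *
            ∏ i, ellipticGamma (x i * w) p q * ellipticGamma (x i * w⁻¹) p q := by
      intro w hw
      have : modThetaProd p t u s w = ∏ i, modTheta (x i * w) p :=
        (prod_vecCons_vecCons (fun y => modTheta (y * w) p) t u s).symm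
      rw [this, ← Finset.prod_mul_distrib]
      refine Finset.prod_congr rfl fun i _ => ?_
      rw [hG _ _ (hx1 i) hw, mul_assoc]
    set G : ℂ := ∏ i, ellipticGamma (x i * z) p q * ellipticGamma (x i * z⁻¹) p q with hGdef
    have hG1 : G = (ellipticGamma (t * z) p q * ellipticGamma (t * z⁻¹) p q) *
        (ellipticGamma (u * z) p q * ellipticGamma (u * z⁻¹) p q) *
        ∏ m, ellipticGamma (s m * z) p q * ellipticGamma (s m * z⁻¹) p q :=
      prod_vecCons_vecCons
        (fun y => ellipticGamma (y * z) p q * ellipticGamma (y * z⁻¹) p q) t u s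
    have hGinv : ∏ i, ellipticGamma (x i * z⁻¹) p q * ellipticGamma (x i * z⁻¹⁻¹) p q = G := by
      rw [inv_inv]
      exact Finset.prod_congr rfl fun i _ => mul_comm _ _
    have w1 : betaWeight p q (vecCons t (vecCons (q * u) s)) z =
        G * modTheta (z ^ 2)⁻¹ q * (z * oddThetaBasis p u z) := by
      unfold betaWeight oddThetaBasis
      rw [prod_vecCons_vecCons
        (fun y => ellipticGamma (y * z) p q * ellipticGamma (y * z⁻¹) p q), hG1,
        mul_assoc q u z, mul_assoc q u z⁻¹, hG u z hu hz1, hG u z⁻¹ hu hz1']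
      field_simp
    have w2 : betaWeight p q (vecCons (q * t) (vecCons u s)) z =
        G * modTheta (z ^ 2)⁻¹ q * (z * oddThetaBasis p t z) := by
      unfold betaWeight oddThetaBasis
      rw [prod_vecCons_vecCons
        (fun y => ellipticGamma (y * z) p q * ellipticGamma (y * z⁻¹) p q), hG1,
        mul_assoc q t z, mul_assoc q t z⁻¹, hG t z ht hz1, hG t z⁻¹ ht hz1']
      field_simp
    simp only [Pi.add_apply, Pi.sub_apply, Pi.smul_apply, smul_eq_mul, w1, w2, hg]
    rw [hprod z hz1, hprod z⁻¹ hz1', ← hGdef, hGinv]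
    have hi : modTheta ((z⁻¹) ^ 2)⁻¹ q = -(z ^ 2) * modTheta (z ^ 2)⁻¹ q := by
      rw [inv_pow, modTheta_inv hq (inv_ne_zero (pow_ne_zero 2 hz0)), inv_inv]
    rw [hi, inv_inv]
    calc _ = G * modTheta (z ^ 2)⁻¹ q * z * (t * modTheta (u * t⁻¹) p *
          ((z ^ 2)⁻¹ * modThetaProd p t u s z - z ^ 2 * modThetaProd p t u s z⁻¹)) := by
            field_simp
            ring
      _ = _ := by rw [hK]; ring
  have := Real.circleAverage_congr_sphere key
  rw [Real.circleAverage_add (hgi.const_smul) (hgi'.const_smul), Real.circleAverage_smul,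
    Real.circleAverage_smul, Real.circleAverage_zero_one_congr_inv, hg0,
    Real.circleAverage_sub (hW1.const_smul) (hW2.const_smul), Real.circleAverage_smul,
    Real.circleAverage_smul] at this
  simp only [smul_eq_mul, mul_zero, add_zero] at this
  exact sub_eq_zero.1 this.symm

end Shift

/-! ### Two parameters with fixed product -/

/-- The quotient of the two sides of the elliptic beta integral, up to the constant factor
`(p; p)_∞ (q; q)_∞ / 2`. -/
noncomputable def betaRatio (p q : ℂ) (t : Fin 6 → ℂ) : ℂ :=
  betaMean p q t / betaProd p q t

section

variable {p q : ℂ}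

theorem Set.Countable.preimage_sq {D : Set ℂ} (hD : D.Countable) :
    {x : ℂ | x ^ 2 ∈ D}.Countable := by
  have h : {x : ℂ | x ^ 2 ∈ D} = ⋃ d ∈ D, {x : ℂ | x ^ 2 = d} := by
    ext x; simp
  rw [h]
  refine hD.biUnion fun d _ => ?_
  obtain ⟨y, hy⟩ := IsAlgClosed.exists_pow_nat_eq d (n := 2) two_pos
  refine Set.Countable.mono (s₂ := {y, -y}) (fun x hx => ?_) (Set.toFinite _).countable
  exact sq_eq_sq_iff_eq_or_eq_neg.1 (show x ^ 2 = y ^ 2 from hx.trans hy.symm)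

theorem norm_lt_norm_mul_of_prod_eq {t u : ℂ} {s : Fin 4 → ℂ} (hp0 : p ≠ 0) (hu : ‖u‖ < 1)
    (hs : ∀ m, ‖s m‖ < 1) (h : t * u * ∏ m, s m = p) (m : Fin 4) : ‖p‖ < ‖s m * t‖ := by
  have e : p = (s m * t) * (u * ∏ n ∈ Finset.univ.erase m, s n) := by
    rw [← h, ← Finset.mul_prod_erase _ s (Finset.mem_univ m)]; ring
  have hne : s m * t ≠ 0 := left_ne_zero_of_mul (e ▸ hp0)
  have hlt : ‖u * ∏ n ∈ Finset.univ.erase m, s n‖ < 1 := by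
    rw [norm_mul, norm_prod]
    exact mul_lt_one_of_nonneg_of_lt_one_left (norm_nonneg _) hu
      (Finset.prod_le_one (fun _ _ => norm_nonneg _) fun i _ => (hs i).le)
  rw [e, norm_mul]
  exact mul_lt_of_lt_one_right (norm_pos_iff.2 hne) hlt

/-- The difference equation for `betaRatio`, for generic `t` and `u`. -/
theorem betaRatio_shift (hp0 : p ≠ 0) (hq0 : q ≠ 0) (hp : ‖p‖ < 1) (hq : ‖q‖ < 1) {t u : ℂ}
    {s : Fin 4 → ℂ} (ht : ‖t‖ < 1) (hu : ‖u‖ < 1) (hs : ∀ m, ‖s m‖ < 1)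
    (h : t * u * ∏ m, s m = p) (ht2 : modTheta (t ^ 2) p ≠ 0) (hu2 : modTheta (u ^ 2) p ≠ 0)
    (htu : modTheta (t * u) p ≠ 0) (hut : modTheta (u * t⁻¹) p ≠ 0) :
    betaRatio p q (vecCons (q * t) (vecCons u s)) =
      betaRatio p q (vecCons t (vecCons (q * u) s)) := by
  have hlt : ∀ x y : ℂ, ‖x‖ < 1 → ‖y‖ < 1 → ‖x * y‖ < 1 := fun x y hx hy => by
    rw [norm_mul]; exact mul_lt_one_of_nonneg_of_lt_one_left (norm_nonneg _) hx hy.le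
  have h1 : ∏ m, modTheta (s m * t) p ≠ 0 := Finset.prod_ne_zero_iff.2 fun m _ =>
    modTheta_ne_zero_of_norm hp (hlt _ _ (hs m) ht) (norm_lt_norm_mul_of_prod_eq hp0 hu hs h m)
  have h2 : ∏ m, modTheta (s m * u) p ≠ 0 := Finset.prod_ne_zero_iff.2 fun m _ =>
    modTheta_ne_zero_of_norm hp (hlt _ _ (hs m) hu)
      (norm_lt_norm_mul_of_prod_eq hp0 ht hs (by rw [mul_comm u, h]) m)
  have hR1 := (isBalanced_vecCons (p := p) (q := q) (hlt q t hq ht) hu hs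
    (by rw [← h]; ring)).betaProd_ne_zero hp0 hq0 hp hq
  have hR2 := (isBalanced_vecCons (p := p) (q := q) ht (hlt q u hq hu) hs
    (by rw [← h]; ring)).betaProd_ne_zero hp0 hq0 hp hq
  have hR := betaProd_shift (p := p) hp hq0 hq ht hu hs
  have hI := betaMean_shift hp0 hq0 hp hq ht hu hs h ht2 hu2 htu hut
  unfold betaRatio
  rw [div_eq_div_iff hR1 hR2]
  refine mul_left_cancel₀ (mul_ne_zero h1 h2) ?_
  linear_combination -(∏ m, modTheta (s m * t) p) *
    betaProd p q (vecCons t (vecCons (q * u) s)) * hI - (∏ m, modTheta (s m * t) p) *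
    betaMean p q (vecCons t (vecCons (q * u) s)) * hR

theorem isBalanced_vecCons_div {B x : ℂ} {s : Fin 4 → ℂ} (hs : ∀ m, ‖s m‖ < 1)
    (h : B * ∏ m, s m = p * q) (hx : ‖B‖ < ‖x‖ ∧ ‖x‖ < 1) :
    IsBalanced p q (vecCons x (vecCons (B / x) s)) := by
  have hx0 : 0 < ‖x‖ := (norm_nonneg _).trans_lt hx.1
  refine isBalanced_vecCons hx.2 ?_ hs ?_
  · rw [norm_div]; exact (div_lt_one hx0).2 hx.1
  · rw [mul_div_cancel₀ _ (norm_pos_iff.1 hx0), h]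

theorem differentiableOn_betaRatio (hp0 : p ≠ 0) (hq0 : q ≠ 0) (hp : ‖p‖ < 1) (hq : ‖q‖ < 1)
    {B : ℂ} {s : Fin 4 → ℂ} (hs : ∀ m, ‖s m‖ < 1) (h : B * ∏ m, s m = p * q) :
    DifferentiableOn ℂ (fun x => betaRatio p q (vecCons x (vecCons (B / x) s)))
      {x : ℂ | ‖B‖ < ‖x‖ ∧ ‖x‖ < 1} := by
  refine differentiableOn_betaMean_div_betaProd hp0 hq0 hp hq (isOpen_annulus _ _)
    (fun x hx => isBalanced_vecCons_div hs h hx) fun j => ?_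
  refine Fin.cases differentiableOn_id (fun j => Fin.cases ?_ (fun m => ?_) j) j
  · refine DifferentiableOn.div (differentiableOn_const _) differentiableOn_id fun x hx => ?_
    exact norm_pos_iff.1 ((norm_nonneg _).trans_lt hx.1)
  · exact differentiableOn_const (s m)

/-- If `|t u| < |q|`, then `betaRatio` at `(t, u, s)` depends only on the product `t u`. -/
theorem betaRatio_eq_of_norm_lt (hp0 : p ≠ 0) (hq0 : q ≠ 0) (hp : ‖p‖ < 1) (hq : ‖q‖ < 1)
    {B : ℂ} {s : Fin 4 → ℂ} (hs : ∀ m, ‖s m‖ < 1) (h : B * ∏ m, s m = p * q) (hB : ‖B‖ < ‖q‖)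
    {x y : ℂ} (hx : ‖B‖ < ‖x‖ ∧ ‖x‖ < 1) (hy : ‖B‖ < ‖y‖ ∧ ‖y‖ < 1) :
    betaRatio p q (vecCons x (vecCons (B / x) s)) =
      betaRatio p q (vecCons y (vecCons (B / y) s)) := by
  set Φ : ℂ → ℂ := fun x => betaRatio p q (vecCons x (vecCons (B / x) s)) with hΦ
  have hB0 : B ≠ 0 := left_ne_zero_of_mul (h ▸ mul_ne_zero hp0 hq0)
  have hd := differentiableOn_betaRatio hp0 hq0 hp hq hs h
  have hqn : 0 < ‖q‖ := norm_pos_iff.2 hq0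
  have hBq : B / q * ∏ m, s m = p := by
    rw [div_mul_eq_mul_div, h, mul_div_cancel_right₀ _ hq0]
  -- the points where one of the theta functions in the difference equation vanishes
  set D : Set ℂ := Set.range (fun n : ℤ => p ^ n) ∪
    (Set.range (fun n : ℤ => (B / q) ^ 2 / p ^ n) ∪ Set.range (fun n : ℤ => B / q / p ^ n)) with hD
  have hDc : D.Countable :=
    (Set.countable_range _).union ((Set.countable_range _).union (Set.countable_range _))
  set U : Set ℂ := {x : ℂ | ‖B‖ < ‖q * x‖ ∧ ‖x‖ < 1} with hU
  have hUo : IsOpen U := (isOpen_lt continuous_const (g := fun x : ℂ => ‖q * x‖)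
    (by fun_prop)).inter (isOpen_lt continuous_norm continuous_const)
  have hU1 : U ⊆ {x : ℂ | ‖B‖ < ‖x‖ ∧ ‖x‖ < 1} := fun x hx => by
    refine ⟨hx.1.trans_le ?_, hx.2⟩
    rw [norm_mul]
    exact mul_le_of_le_one_left (norm_nonneg _) hq.le
  have hU2 : ∀ x ∈ U, q * x ∈ {x : ℂ | ‖B‖ < ‖x‖ ∧ ‖x‖ < 1} := fun x hx => by
    refine ⟨hx.1, ?_⟩
    rw [norm_mul]
    exact mul_lt_one_of_nonneg_of_lt_one_left (norm_nonneg _) hq hx.2.le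
  have hgen : Set.EqOn (fun x => Φ (q * x)) Φ (U ∩ {x : ℂ | x ^ 2 ∈ D}ᶜ) := by
    rintro x ⟨hxU, hxD⟩
    have hx0 : x ≠ 0 := norm_pos_iff.1 ((norm_nonneg _).trans_lt (hU1 hxU).1)
    have hxD' : x ^ 2 ∉ D := hxD
    simp only [hD, Set.mem_union, Set.mem_range, not_or, not_exists] at hxD'
    obtain ⟨h1, h2, h3⟩ := hxD'
    have hpn : ∀ n : ℤ, p ^ n ≠ 0 := fun n => zpow_ne_zero n hp0
    have hu0 : B / (q * x) ≠ 0 := div_ne_zero hB0 (mul_ne_zero hq0 hx0)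
    have htu : x * (B / (q * x)) = B / q := by field_simp
    have key := betaRatio_shift hp0 hq0 hp hq (t := x) (u := B / (q * x)) hxU.2
      (by rw [norm_div]; exact (div_lt_one ((norm_nonneg _).trans_lt hxU.1)).2 hxU.1) hs
      (by rw [htu, hBq])
      (modTheta_ne_zero hp0 hp (pow_ne_zero 2 hx0) fun n hn => h1 n hn.symm)
      (modTheta_ne_zero hp0 hp (pow_ne_zero 2 hu0) fun n hn => h2 n (by
        rw [← hn]; field_simp))
      (by
        rw [htu]
        refine modTheta_ne_zero_of_norm hp ?_ ?_
        · rw [norm_div]; exact (div_lt_one hqn).2 hB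
        · conv_lhs => rw [← hBq]
          rw [norm_mul]
          exact mul_lt_of_lt_one_right (norm_pos_iff.2 (div_ne_zero hB0 hq0))
            (norm_prod_lt_one hs _ Finset.univ_nonempty))
      (modTheta_ne_zero hp0 hp (mul_ne_zero hu0 (inv_ne_zero hx0)) fun n hn => h3 n (by
        rw [← hn]; field_simp))
    have e : q * (B / (q * x)) = B / x := by field_simp
    rw [e] at key
    exact key
  have hinv : Set.EqOn (fun x => Φ (q * x)) Φ U := by
    refine hgen.of_subset_closure ?_ (hd.continuousOn.mono hU1) Set.inter_subset_left ?_
    · exact hd.continuousOn.comp (f := fun x => q * x) (by fun_prop) hU2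
    · exact (hDc.preimage_sq.dense_compl ℂ).open_subset_closure_inter hUo
  exact eq_of_differentiableOn_annulus_of_mul_invariant (norm_pos_iff.2 hB0) hB hq hd
    (fun x hx1 hx2 => hinv ⟨hx1, hx2⟩) hx hy

/-- If `betaRatio` at `(t, u, s)` is known whenever `|t| < ρ`, it is known for all `t` and `u` with
the same product. -/
theorem betaRatio_eq_of_forall_norm_lt (hp0 : p ≠ 0) (hq0 : q ≠ 0) (hp : ‖p‖ < 1) (hq : ‖q‖ < 1)
    {B : ℂ} {s : Fin 4 → ℂ} (hs : ∀ m, ‖s m‖ < 1) (h : B * ∏ m, s m = p * q) {ρ : ℝ}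
    (hB : ‖B‖ < ρ) {c : ℂ}
    (hc : ∀ x : ℂ, ‖B‖ < ‖x‖ → ‖x‖ < 1 → ‖x‖ < ρ →
      betaRatio p q (vecCons x (vecCons (B / x) s)) = c)
    {x : ℂ} (hx : ‖B‖ < ‖x‖ ∧ ‖x‖ < 1) :
    betaRatio p q (vecCons x (vecCons (B / x) s)) = c :=
  eq_const_of_differentiableOn_annulus
    (norm_pos_iff.2 (left_ne_zero_of_mul (h ▸ mul_ne_zero hp0 hq0))) hB
    (differentiableOn_betaRatio hp0 hq0 hp hq hs h) hc hx

end

/-! ### A Poisson kernel limit -/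

section Poisson

open Real

theorem norm_one_sub_le_norm_one_add_mul_sq {a : ℝ} (ha : 0 ≤ a) {z : ℂ} (hz : ‖z‖ = 1) :
    1 - a ≤ ‖1 + a * z ^ 2‖ := by
  have h := norm_sub_norm_le (1 : ℂ) (-(a * z ^ 2))
  rw [sub_neg_eq_add, norm_neg, norm_mul, norm_pow, hz, Complex.norm_real,
    Real.norm_of_nonneg ha] at h
  simpa using h

theorem norm_one_add_sq_le {a : ℝ} (ha : 0 ≤ a) (ha1 : a ≤ 1) {z : ℂ} (hz : ‖z‖ = 1) :
    ‖1 + z ^ 2‖ ≤ 2 * ‖1 + a * z ^ 2‖ := by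
  have e : 1 + z ^ 2 = (1 + a * z ^ 2) + ((1 - a : ℝ) : ℂ) * z ^ 2 := by push_cast; ring
  have h := norm_add_le (1 + a * z ^ 2) (((1 - a : ℝ) : ℂ) * z ^ 2)
  rw [← e, norm_mul, norm_pow, hz, Complex.norm_real, Real.norm_of_nonneg (by linarith)] at h
  have := norm_one_sub_le_norm_one_add_mul_sq ha hz
  linarith

/-- The Poisson kernel `(1 - a²) / |1 + a z²|²` in the variable `z²`, with poles near `z² = -1`. -/
noncomputable def sqPoissonKernel (a : ℝ) (z : ℂ) : ℝ :=
  (1 - a ^ 2) / ‖1 + a * z ^ 2‖ ^ 2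

theorem one_add_mul_sq_mul_inv {a : ℝ} {z : ℂ} (hz : ‖z‖ = 1) :
    (1 + a * z ^ 2) * (1 + a * (z ^ 2)⁻¹) = ((‖1 + a * z ^ 2‖ ^ 2 : ℝ) : ℂ) := by
  have h : (1 + a * (z ^ 2)⁻¹) = (starRingEnd ℂ) (1 + a * z ^ 2) := by
    have : (starRingEnd ℂ) z = z⁻¹ := by
      rw [Complex.inv_def, Complex.normSq_eq_norm_sq, hz]; simp
    simp [this]
  rw [h, Complex.mul_conj, Complex.normSq_eq_norm_sq]

theorem ofReal_sqPoissonKernel {a : ℝ} {z : ℂ} (hz : ‖z‖ = 1) :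
    (sqPoissonKernel a z : ℂ) = (1 - a ^ 2) / ((1 + a * z ^ 2) * (1 + a * (z ^ 2)⁻¹)) := by
  rw [one_add_mul_sq_mul_inv hz, sqPoissonKernel]
  push_cast
  rfl

variable {a : ℝ}

theorem sqPoissonKernel_nonneg (ha : 0 ≤ a) (ha1 : a < 1) (z : ℂ) : 0 ≤ sqPoissonKernel a z :=
  div_nonneg (by nlinarith) (by positivity)

theorem one_add_mul_sq_ne_zero (ha : 0 ≤ a) (ha1 : a < 1) {z : ℂ} (hz : ‖z‖ ≤ 1) :
    1 + a * z ^ 2 ≠ 0 := by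
  intro h
  have h2 : -((a : ℂ) * z ^ 2) = 1 := by linear_combination -h
  have h3 := congrArg norm h2
  rw [norm_neg, norm_mul, norm_pow, Complex.norm_real, Real.norm_of_nonneg ha, norm_one] at h3
  have := pow_le_one₀ (n := 2) (norm_nonneg z) hz
  nlinarith [sq_nonneg ‖z‖]

theorem continuousOn_sqPoissonKernel (ha : 0 ≤ a) (ha1 : a < 1) :
    ContinuousOn (sqPoissonKernel a) (Metric.sphere 0 1) := by
  refine ContinuousOn.div continuousOn_const (by fun_prop) fun z hz => ?_
  exact pow_ne_zero 2 (norm_ne_zero_iff.2 (one_add_mul_sq_ne_zero ha ha1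
    (by simpa using (mem_sphere_zero_iff_norm.1 hz).le)))

theorem circleAverage_sqPoissonKernel (ha : 0 ≤ a) (ha1 : a < 1) :
    circleAverage (sqPoissonKernel a) 0 1 = 1 := by
  set f : ℂ → ℂ := fun z => (1 + a * z ^ 2)⁻¹ with hf
  have hfd : ∀ z : ℂ, ‖z‖ ≤ 1 → DifferentiableAt ℂ f z := fun z hz => by
    have := one_add_mul_sq_ne_zero ha ha1 hz
    exact DifferentiableAt.inv (by fun_prop) this
  have hf1 : circleAverage f 0 1 = 1 := by
    rw [DiffContOnCl.circleAverage]
    · simp [hf]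
    · refine DifferentiableOn.diffContOnCl fun z hz => ?_
      rw [abs_one, closure_ball _ one_ne_zero] at hz
      exact (hfd z (by simpa using hz)).differentiableWithinAt
  have hfc : ContinuousOn f (Metric.sphere 0 1) := fun z hz =>
    (hfd z (by simpa using (mem_sphere_zero_iff_norm.1 hz).le)).continuousAt.continuousWithinAt
  have hfi : CircleIntegrable f 0 1 := hfc.circleIntegrable zero_le_one
  have hfi' : CircleIntegrable (fun z => f z⁻¹) 0 1 := by
    refine ContinuousOn.circleIntegrable zero_le_one (hfc.comp (f := fun z => z⁻¹) ?_ ?_)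
    · intro z hz
      have hz0 : z ≠ 0 := by rintro rfl; simp at hz
      exact (continuousAt_inv₀ hz0).continuousWithinAt
    · intro z hz
      simpa using hz
  have hK : Set.EqOn (Complex.ofRealCLM ∘ sqPoissonKernel a)
      ((f + fun z => f z⁻¹) - fun _ => (1 : ℂ)) (Metric.sphere 0 |1|) := by
    intro z hz
    have hz1 : ‖z‖ = 1 := by simpa using hz
    have h1 := one_add_mul_sq_ne_zero ha ha1 hz1.le
    have h2 := one_add_mul_sq_ne_zero ha ha1 (z := z⁻¹) (by rw [norm_inv, hz1, inv_one])
    have hz0 : z ≠ 0 := by rintro rfl; simp at hz1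
    simp only [Function.comp_apply, Complex.ofRealCLM_apply, Pi.sub_apply, Pi.add_apply, hf]
    rw [ofReal_sqPoissonKernel hz1]
    rw [inv_pow] at h2 ⊢
    rw [div_eq_iff (mul_ne_zero h1 h2)]
    have h3 : z ^ 2 * (z ^ 2)⁻¹ = 1 := mul_inv_cancel₀ (pow_ne_zero 2 hz0)
    generalize (z ^ 2)⁻¹ = w at *
    field_simp
    linear_combination (a : ℂ) ^ 2 * h3
  have key := Real.circleAverage_congr_sphere hK
  rw [ContinuousLinearMap.circleAverage_comp_comm _
    ((continuousOn_sqPoissonKernel ha ha1).circleIntegrable zero_le_one),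
    Real.circleAverage_sub (hfi.add hfi') (circleIntegrable_const _ _ _),
    Real.circleAverage_add hfi hfi', Real.circleAverage_zero_one_congr_inv, hf1,
    Real.circleAverage_const] at key
  have : ((circleAverage (sqPoissonKernel a) 0 1 : ℝ) : ℂ) = (1 : ℝ) := by
    rw [← Complex.ofRealCLM_apply, key]; simp
  exact_mod_cast this

/-- As `r → 1⁻` the kernels concentrate at `z = ±i`. -/
theorem tendsto_circleAverage_sqPoissonKernel {H : ℝ → ℂ → ℂ} {r₀ : ℝ} (h0 : 0 < r₀) (h1 : r₀ < 1)
    (hH : ContinuousOn (fun x : ℝ × ℂ => H x.1 x.2) (Set.Icc r₀ 1 ×ˢ Metric.sphere 0 1)) {c : ℂ}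
    (hI : H 1 Complex.I = c) (hI' : H 1 (-Complex.I) = c) :
    Tendsto (fun r : ℝ => circleAverage (fun z => (sqPoissonKernel (r ^ 2) z : ℂ) * H r z) 0 1)
      (𝓝[<] 1) (𝓝 c) := by
  have hbound : ∀ ε > 0, ∃ C : ℝ, 0 ≤ C ∧ ∀ r ∈ Set.Icc r₀ 1, ∀ z : ℂ, ‖z‖ = 1 →
      ‖H r z - c‖ ≤ ε + C * (‖1 + z ^ 2‖ ^ 2 + (1 - r)) := by
    intro ε hε
    set S : Set (ℝ × ℂ) := Set.Icc r₀ 1 ×ˢ Metric.sphere 0 1 with hS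
    have hSc : IsCompact S := isCompact_Icc.prod (isCompact_sphere _ _)
    have hnc : ContinuousOn (fun x : ℝ × ℂ => ‖H x.1 x.2 - c‖) S := (hH.sub continuousOn_const).norm
    set S' : Set (ℝ × ℂ) := S ∩ (fun x : ℝ × ℂ => ‖H x.1 x.2 - c‖) ⁻¹' Set.Ici ε with hS'
    have hS'c : IsCompact S' :=
      hSc.of_isClosed_subset (hnc.preimage_isClosed_of_isClosed hSc.isClosed isClosed_Ici)
        Set.inter_subset_left
    have hpos : ∀ x ∈ S', 0 < ‖1 + x.2 ^ 2‖ ^ 2 + (1 - x.1) := by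
      rintro ⟨r, z⟩ ⟨⟨hr, hz⟩, hx⟩
      by_contra hcon
      simp only at hr hz hcon
      have hr1 : r = 1 := by
        have := hr.2
        nlinarith [sq_nonneg ‖1 + z ^ 2‖]
      have hz1 : 1 + z ^ 2 = 0 := by
        rw [hr1] at hcon
        have : ‖1 + z ^ 2‖ ^ 2 = 0 := le_antisymm (by linarith) (by positivity)
        simpa using this
      have hz2 : z = Complex.I ∨ z = -Complex.I := by
        apply sq_eq_sq_iff_eq_or_eq_neg.1
        rw [Complex.I_sq]
        linear_combination hz1
      have hx' : ε ≤ ‖H r z - c‖ := hx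
      have : H r z = c := by
        rw [hr1]
        rcases hz2 with rfl | rfl
        exacts [hI, hI']
      rw [this, sub_self, norm_zero] at hx'
      linarith
    obtain ⟨C, hC⟩ := hS'c.exists_bound_of_continuousOn
      (f := fun x : ℝ × ℂ => ‖H x.1 x.2 - c‖ / (‖1 + x.2 ^ 2‖ ^ 2 + (1 - x.1)))
      ((hnc.mono Set.inter_subset_left).div (by fun_prop) fun x hx => (hpos x hx).ne')
    refine ⟨max C 0, le_max_right _ _, fun r hr z hz => ?_⟩
    have hψ : 0 ≤ ‖1 + z ^ 2‖ ^ 2 + (1 - r) := by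
      have := hr.2
      nlinarith [sq_nonneg ‖1 + z ^ 2‖]
    by_cases hx : ε ≤ ‖H r z - c‖
    · have hxS : (r, z) ∈ S' := ⟨⟨hr, by simpa using hz⟩, hx⟩
      have h2 := (le_abs_self _).trans (hC _ hxS)
      have h3 := (div_le_iff₀ (hpos _ hxS)).1 h2
      have h4 := mul_le_mul_of_nonneg_right (le_max_left C 0) hψ
      simp only at h3
      linarith
    · have := mul_nonneg (le_max_right C 0) hψ
      linarith
  rw [Metric.tendsto_nhds]
  intro ε hε
  obtain ⟨C, hC0, hC⟩ := hbound (ε / 2) (by linarith)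
  have hlim : Tendsto (fun r : ℝ => ε / 2 + C * (4 * (1 - (r ^ 2) ^ 2) + (1 - r))) (𝓝[<] 1)
      (𝓝 (ε / 2)) := by
    have : Tendsto (fun r : ℝ => ε / 2 + C * (4 * (1 - (r ^ 2) ^ 2) + (1 - r))) (𝓝 1)
      (𝓝 (ε / 2 + C * (4 * (1 - ((1 : ℝ) ^ 2) ^ 2) + (1 - 1)))) :=
      Continuous.tendsto (by fun_prop) 1
    norm_num at this
    exact this.mono_left nhdsWithin_le_nhds
  filter_upwards [hlim.eventually (gt_mem_nhds (show ε / 2 < ε by linarith)),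
    Ico_mem_nhdsLT h1] with r hr hrI
  refine lt_of_le_of_lt ?_ hr
  have hr0 : 0 ≤ r ^ 2 := by positivity
  have hr1 : r ^ 2 < 1 := by nlinarith [hrI.1, hrI.2]
  have hrI' : r ∈ Set.Icc r₀ 1 := ⟨hrI.1, hrI.2.le⟩
  have hKc := continuousOn_sqPoissonKernel hr0 hr1
  have hKi := hKc.circleIntegrable zero_le_one
  have hKcc : ContinuousOn (fun z => (sqPoissonKernel (r ^ 2) z : ℂ)) (Metric.sphere 0 1) :=
    Complex.continuous_ofReal.comp_continuousOn hKc
  have hHr : ContinuousOn (H r) (Metric.sphere 0 1) :=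
    hH.comp (f := fun z => (r, z)) (by fun_prop) fun z hz => ⟨hrI', hz⟩
  have hKone : circleAverage (fun z => (sqPoissonKernel (r ^ 2) z : ℂ)) 0 1 = 1 := by
    have := ContinuousLinearMap.circleAverage_comp_comm Complex.ofRealCLM hKi
    rw [circleAverage_sqPoissonKernel hr0 hr1] at this
    exact this.trans Complex.ofReal_one
  have hsub : circleAverage (fun z => (sqPoissonKernel (r ^ 2) z : ℂ) * H r z) 0 1 - c =
      circleAverage (fun z => (sqPoissonKernel (r ^ 2) z : ℂ) * (H r z - c)) 0 1 := by
    have e : (fun z => (sqPoissonKernel (r ^ 2) z : ℂ) * (H r z - c)) =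
        ((fun z => (sqPoissonKernel (r ^ 2) z : ℂ)) * H r) -
          c • fun z => (sqPoissonKernel (r ^ 2) z : ℂ) := by
      funext z
      simp only [Pi.sub_apply, Pi.mul_apply, Pi.smul_apply, smul_eq_mul]
      ring
    rw [e, Real.circleAverage_sub ((hKcc.mul hHr).circleIntegrable zero_le_one)
      (hKcc.circleIntegrable zero_le_one).const_smul, Real.circleAverage_smul, hKone, smul_eq_mul,
      mul_one]
    rfl
  rw [dist_eq_norm, hsub]
  have hnorm : ‖circleAverage (fun z => (sqPoissonKernel (r ^ 2) z : ℂ) * (H r z - c)) 0 1‖ ≤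
      circleAverage (fun z => ‖(sqPoissonKernel (r ^ 2) z : ℂ) * (H r z - c)‖) 0 1 := by
    rw [circleAverage_def, circleAverage_def, norm_smul, smul_eq_mul,
      Real.norm_of_nonneg (inv_nonneg.2 two_pi_pos.le)]
    exact mul_le_mul_of_nonneg_left
      (intervalIntegral.norm_integral_le_integral_norm two_pi_pos.le) (inv_nonneg.2 two_pi_pos.le)
  refine hnorm.trans ?_
  have hmono : circleAverage (fun z => ‖(sqPoissonKernel (r ^ 2) z : ℂ) * (H r z - c)‖) 0 1 ≤
      circleAverage ((ε / 2 + C * (1 - r)) • sqPoissonKernel (r ^ 2) +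
        fun _ => C * (4 * (1 - (r ^ 2) ^ 2))) 0 1 := by
    refine Real.circleAverage_mono
      ((hKcc.mul (hHr.sub continuousOn_const)).norm.circleIntegrable zero_le_one)
      (hKi.const_smul.add (circleIntegrable_const _ _ _)) fun z hz => ?_
    have hz1 : ‖z‖ = 1 := by simpa using hz
    have hK0 := sqPoissonKernel_nonneg hr0 hr1 z
    have hne : 0 < ‖1 + ((r ^ 2 : ℝ) : ℂ) * z ^ 2‖ :=
      norm_pos_iff.2 (one_add_mul_sq_ne_zero hr0 hr1 hz1.le)
    have hKz : sqPoissonKernel (r ^ 2) z * ‖1 + z ^ 2‖ ^ 2 ≤ 4 * (1 - (r ^ 2) ^ 2) := by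
      have h2 := norm_one_add_sq_le hr0 hr1.le hz1
      rw [sqPoissonKernel, div_mul_eq_mul_div, div_le_iff₀ (by positivity)]
      have h3 : ‖1 + z ^ 2‖ ^ 2 ≤ (2 * ‖1 + ((r ^ 2 : ℝ) : ℂ) * z ^ 2‖) ^ 2 :=
        pow_le_pow_left₀ (norm_nonneg _) h2 2
      have h4 : 0 ≤ 1 - (r ^ 2) ^ 2 := by nlinarith
      nlinarith
    simp only [Pi.add_apply, Pi.smul_apply, smul_eq_mul]
    rw [norm_mul, Complex.norm_real, Real.norm_of_nonneg hK0]
    have h5 := mul_le_mul_of_nonneg_left (hC r hrI' z hz1) hK0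
    have h6 := mul_le_mul_of_nonneg_left hKz hC0
    nlinarith
  refine hmono.trans (le_of_eq ?_)
  rw [Real.circleAverage_add hKi.const_smul (circleIntegrable_const _ _ _),
    Real.circleAverage_smul, circleAverage_sqPoissonKernel hr0 hr1, Real.circleAverage_const,
    smul_eq_mul]
  ring

end Poisson

/-! ### The constant -/

section

variable {p q : ℂ}

/-- The function `(1 - z) Γ(z; p, q)`, which is regular at `z = 1`. -/
noncomputable def regEllipticGamma (z p q : ℂ) : ℂ :=
  doublePochhammer (p * q / z) p q / (qPochhammerInf (q * z) q * doublePochhammer (p * z) p q)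

theorem ellipticGamma_eq_regEllipticGamma_div (hp : ‖p‖ < 1) (hq : ‖q‖ < 1) (z : ℂ) :
    ellipticGamma z p q = regEllipticGamma z p q / (1 - z) := by
  rw [ellipticGamma_eq_div hp hq, doublePochhammer_eq_mul_left hp hq z,
    qPochhammerInf_eq_one_sub_mul hq z, regEllipticGamma, div_div]
  congr 1
  ring

theorem norm_mul_lt_one_of_le {x z : ℂ} (hx : ‖x‖ < 1) (hz : ‖z‖ ≤ 1) : ‖x * z‖ < 1 := by
  rw [norm_mul]
  exact mul_lt_one_of_nonneg_of_lt_one_left (norm_nonneg _) hx hz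

theorem regEllipticGamma_denom_ne_zero (hp : ‖p‖ < 1) (hq : ‖q‖ < 1) {z : ℂ} (hz : ‖z‖ ≤ 1) :
    qPochhammerInf (q * z) q * doublePochhammer (p * z) p q ≠ 0 :=
  mul_ne_zero (qPochhammerInf_ne_zero_of_norm_lt_one hq (norm_mul_lt_one_of_le hq hz))
    (doublePochhammer_ne_zero hp hq (norm_mul_lt_one_of_le hp hz))

theorem continuousAt_regEllipticGamma (hp : ‖p‖ < 1) (hq : ‖q‖ < 1) {z : ℂ} (hz0 : z ≠ 0)
    (hz : ‖z‖ ≤ 1) : ContinuousAt (fun z => regEllipticGamma z p q) z := by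
  have h1 := (differentiable_doublePochhammer hp hq).continuous
  have h2 := (differentiable_qPochhammerInf hq).continuous
  refine ContinuousAt.div ?_ (by fun_prop) (regEllipticGamma_denom_ne_zero hp hq hz)
  exact h1.continuousAt.comp (f := fun z => p * q / z) (by fun_prop (disch := exact hz0))

theorem regEllipticGamma_ne_zero (hp : ‖p‖ < 1) (hq : ‖q‖ < 1) {z : ℂ} (hz : ‖z‖ = 1) :
    regEllipticGamma z p q ≠ 0 := by
  refine div_ne_zero (doublePochhammer_ne_zero hp hq ?_)
    (regEllipticGamma_denom_ne_zero hp hq hz.le)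
  rw [norm_div, hz, div_one]
  exact norm_mul_lt_one_of_le hp hq.le

theorem regEllipticGamma_one (hp : ‖p‖ < 1) (hq : ‖q‖ < 1) :
    regEllipticGamma 1 p q = (qPochhammerInf p p * qPochhammerInf q q)⁻¹ := by
  have h := regEllipticGamma_denom_ne_zero hp hq (z := 1) (by simp)
  rw [mul_one, mul_one] at h
  have h1 : doublePochhammer (p * q) p q ≠ 0 :=
    doublePochhammer_ne_zero hp hq (norm_mul_lt_one_of_le hp hq.le)
  have h2 := qPochhammerInf_ne_zero_of_norm_lt_one hp hp
  have h3 := qPochhammerInf_ne_zero_of_norm_lt_one hq hq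
  rw [regEllipticGamma, div_one, mul_one, mul_one, doublePochhammer_eq_mul_right hp hq p,
    mul_comm q p]
  field_simp

/-- The factor of the integrand at `z = ±i` that involves neither `regEllipticGamma 1 p q` nor the
other four parameters. -/
theorem regEllipticGamma_neg_one_sq (hp : ‖p‖ < 1) (hq : ‖q‖ < 1) :
    regEllipticGamma (-1) p q ^ 2 * (modTheta (-1) p * modTheta (-1) q) = 4 := by
  have h := inv_ellipticGamma_mul_inv (p := p) (q := q) hp hq (z := -1) (by simp)
  have h1 := regEllipticGamma_ne_zero (p := p) (q := q) hp hq (z := -1) (by simp)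
  have e : ((-1 : ℂ))⁻¹ = -1 := by norm_num
  rw [e, ellipticGamma_eq_regEllipticGamma_div hp hq] at h
  rw [← h]
  field_simp
  norm_num

theorem continuousOn_ellipticGamma_comp (hp : ‖p‖ < 1) (hq : ‖q‖ < 1) {X : Type*}
    [TopologicalSpace X] {S : Set X} {f : X → ℂ} (hf : ContinuousOn f S)
    (h : ∀ x ∈ S, f x ≠ 0 ∧ ‖f x‖ < 1) : ContinuousOn (fun x => ellipticGamma (f x) p q) S :=
  fun x hx => (differentiableAt_ellipticGamma hp hq (h x hx).1
    (h x hx).2).continuousAt.comp_continuousWithinAt (hf x hx)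

theorem continuousOn_regEllipticGamma_comp (hp : ‖p‖ < 1) (hq : ‖q‖ < 1) {X : Type*}
    [TopologicalSpace X] {S : Set X} {f : X → ℂ} (hf : ContinuousOn f S)
    (h : ∀ x ∈ S, f x ≠ 0 ∧ ‖f x‖ ≤ 1) : ContinuousOn (fun x => regEllipticGamma (f x) p q) S :=
  fun x hx => (continuousAt_regEllipticGamma hp hq (h x hx).1
    (h x hx).2).comp_continuousWithinAt (hf x hx)

theorem continuousOn_modTheta_comp (hp : ‖p‖ < 1) {X : Type*}
    [TopologicalSpace X] {S : Set X} {f : X → ℂ} (hf : ContinuousOn f S)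
    (h : ∀ x ∈ S, f x ≠ 0) : ContinuousOn (fun x => modTheta (f x) p) S :=
  fun x hx => (differentiableAt_modTheta hp (h x hx)).continuousAt.comp_continuousWithinAt
    (hf x hx)

/-- For four parameters with product `p q` the pair product is trivial, by the reflection
formula. -/
theorem prod_pair_ellipticGamma_eq_one (hp0 : p ≠ 0) (hq0 : q ≠ 0) (hp : ‖p‖ < 1) (hq : ‖q‖ < 1)
    {v : Fin 4 → ℂ} (hv : ∀ m, ‖v m‖ < 1) (h : ∏ m, v m = p * q) :
    ∏ m, ∏ n ∈ Finset.Ioi m, ellipticGamma (v m * v n) p q = 1 := by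
  rw [Fin.prod_univ_four] at h
  have hlt : ∀ i j, ‖v i * v j‖ < 1 := fun i j => norm_mul_lt_one_of_le (hv i) (hv j).le
  have h1 := ellipticGamma_mul_ellipticGamma_of_mul_eq hp0 hq0 hp hq (hlt 0 1) (hlt 2 3)
    (by linear_combination h)
  have h2 := ellipticGamma_mul_ellipticGamma_of_mul_eq hp0 hq0 hp hq (hlt 0 2) (hlt 1 3)
    (by linear_combination h)
  have h3 := ellipticGamma_mul_ellipticGamma_of_mul_eq hp0 hq0 hp hq (hlt 0 3) (hlt 1 2)
    (by linear_combination h)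
  have i0 : Finset.Ioi (0 : Fin 4) = {1, 2, 3} := by decide
  have i1 : Finset.Ioi (1 : Fin 4) = {2, 3} := by decide
  have i2 : Finset.Ioi (2 : Fin 4) = {3} := by decide
  have i3 : Finset.Ioi (3 : Fin 4) = ∅ := by decide
  rw [Fin.prod_univ_four, i0, i1, i2, i3, Finset.prod_insert (by decide),
    Finset.prod_pair (by decide), Finset.prod_pair (by decide), Finset.prod_singleton,
    Finset.prod_empty]
  calc _ = (ellipticGamma (v 0 * v 1) p q * ellipticGamma (v 2 * v 3) p q) *
        (ellipticGamma (v 0 * v 2) p q * ellipticGamma (v 1 * v 3) p q) *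
        (ellipticGamma (v 0 * v 3) p q * ellipticGamma (v 1 * v 2) p q) := by ring
    _ = 1 := by rw [h1, h2, h3]; norm_num

/-- The value of `betaRatio` along a family `(i r, -i r, v r)` on which it is constant, from the
limit `r → 1⁻`: there the poles at `z = ± i r` and `z = ± i / r` pinch the circle. -/
theorem betaRatio_eq_of_eq_on_family (hp0 : p ≠ 0) (hq0 : q ≠ 0) (hp : ‖p‖ < 1) (hq : ‖q‖ < 1)
    {r₀ : ℝ} (h0 : 0 < r₀) (h1 : r₀ < 1) {v : ℝ → Fin 4 → ℂ}
    (hvc : ∀ m, ContinuousOn (fun r => v r m) (Set.Icc r₀ 1))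
    (hv : ∀ r ∈ Set.Icc r₀ 1, ∀ m, ‖v r m‖ < 1)
    (hvp : ∀ r ∈ Set.Icc r₀ 1, (r : ℂ) ^ 2 * ∏ m, v r m = p * q) {L : ℂ}
    (hL : ∀ r ∈ Set.Ico r₀ 1, betaRatio p q
      (vecCons (Complex.I * r) (vecCons (-(Complex.I * r)) (v r))) = L) :
    qPochhammerInf p p * qPochhammerInf q q / 2 * L = 1 := by
  have hv0 : ∀ r ∈ Set.Icc r₀ 1, ∀ m, v r m ≠ 0 := fun r hr m =>
    Finset.prod_ne_zero_iff.1 (right_ne_zero_of_mul ((hvp r hr) ▸ mul_ne_zero hp0 hq0)) m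
      (Finset.mem_univ m)
  have hr0 : ∀ r ∈ Set.Icc r₀ 1, (r : ℂ) ≠ 0 := fun r hr =>
    Complex.ofReal_ne_zero.2 (h0.trans_le hr.1).ne'
  have hrn : ∀ r ∈ Set.Icc r₀ 1, ‖(r : ℂ)‖ ≤ 1 := fun r hr => by
    rw [Complex.norm_real, Real.norm_of_nonneg (h0.le.trans hr.1)]; exact hr.2
  have hz0 : ∀ z ∈ Metric.sphere (0 : ℂ) 1, z ≠ 0 := fun z hz => by rintro rfl; simp at hz
  set X : ℝ → ℂ → ℂ := fun r z =>
    ∏ m, ellipticGamma (v r m * z) p q * ellipticGamma (v r m * z⁻¹) p q with hX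
  set H : ℝ → ℂ → ℂ := fun r z =>
    (regEllipticGamma (Complex.I * r * z) p q * regEllipticGamma (Complex.I * r * z⁻¹) p q) *
    (regEllipticGamma (-(Complex.I * r) * z) p q *
      regEllipticGamma (-(Complex.I * r) * z⁻¹) p q) * X r z *
    (modTheta (z ^ 2) p * modTheta (z ^ 2)⁻¹ q) with hH
  have hHc : ContinuousOn (fun x : ℝ × ℂ => H x.1 x.2) (Set.Icc r₀ 1 ×ˢ Metric.sphere 0 1) := by
    have hinv : ContinuousOn (fun x : ℝ × ℂ => x.2⁻¹) (Set.Icc r₀ 1 ×ˢ Metric.sphere 0 1) :=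
      continuousOn_snd.inv₀ fun x hx => hz0 _ hx.2
    have hrc : ContinuousOn (fun x : ℝ × ℂ => Complex.I * (x.1 : ℂ))
      (Set.Icc r₀ 1 ×ˢ Metric.sphere 0 1) := by fun_prop
    have hvc' : ∀ m, ContinuousOn (fun x : ℝ × ℂ => v x.1 m)
        (Set.Icc r₀ 1 ×ˢ Metric.sphere 0 1) := fun m =>
      (hvc m).comp continuousOn_fst fun x hx => hx.1
    have hnI : ∀ r ∈ Set.Icc r₀ 1, ∀ z ∈ Metric.sphere (0 : ℂ) 1,
        ‖Complex.I * r * z‖ ≤ 1 := fun r hr z hz => by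
      rw [norm_mul, norm_mul, Complex.norm_I, one_mul, mem_sphere_zero_iff_norm.1 hz, mul_one]
      exact hrn r hr
    have hinvs : ∀ z ∈ Metric.sphere (0 : ℂ) 1, z⁻¹ ∈ Metric.sphere (0 : ℂ) 1 := fun z hz => by
      simpa using hz
    have hne : ∀ r ∈ Set.Icc r₀ 1, ∀ z ∈ Metric.sphere (0 : ℂ) 1, Complex.I * r * z ≠ 0 :=
      fun r hr z hz => mul_ne_zero (mul_ne_zero Complex.I_ne_zero (hr0 r hr)) (hz0 z hz)
    refine ContinuousOn.mul (ContinuousOn.mul (ContinuousOn.mul (ContinuousOn.mul ?_ ?_)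
      (ContinuousOn.mul ?_ ?_)) (continuousOn_finsetProd _ fun m _ => ContinuousOn.mul ?_ ?_))
      (ContinuousOn.mul ?_ ?_)
    · exact continuousOn_regEllipticGamma_comp hp hq (hrc.mul continuousOn_snd) fun x hx =>
        ⟨hne _ hx.1 _ hx.2, hnI _ hx.1 _ hx.2⟩
    · exact continuousOn_regEllipticGamma_comp hp hq (hrc.mul hinv) fun x hx =>
        ⟨hne _ hx.1 _ (hinvs _ hx.2), hnI _ hx.1 _ (hinvs _ hx.2)⟩
    · refine continuousOn_regEllipticGamma_comp hp hq (hrc.neg.mul continuousOn_snd) fun x hx => ?_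
      rw [neg_mul, norm_neg]
      exact ⟨neg_ne_zero.2 (hne _ hx.1 _ hx.2), hnI _ hx.1 _ hx.2⟩
    · refine continuousOn_regEllipticGamma_comp hp hq (hrc.neg.mul hinv) fun x hx => ?_
      rw [neg_mul, norm_neg]
      exact ⟨neg_ne_zero.2 (hne _ hx.1 _ (hinvs _ hx.2)), hnI _ hx.1 _ (hinvs _ hx.2)⟩
    · exact continuousOn_ellipticGamma_comp hp hq ((hvc' m).mul continuousOn_snd) fun x hx =>
        ⟨mul_ne_zero (hv0 _ hx.1 m) (hz0 _ hx.2), norm_mul_lt_one_of_norm_eq_one (hv _ hx.1 m)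
          (mem_sphere_zero_iff_norm.1 hx.2)⟩
    · exact continuousOn_ellipticGamma_comp hp hq ((hvc' m).mul hinv) fun x hx =>
        ⟨mul_ne_zero (hv0 _ hx.1 m) (inv_ne_zero (hz0 _ hx.2)), norm_mul_lt_one_of_norm_eq_one
          (hv _ hx.1 m) (mem_sphere_zero_iff_norm.1 (hinvs _ hx.2))⟩
    · exact continuousOn_modTheta_comp hp (continuousOn_snd.pow 2) fun x hx =>
        pow_ne_zero 2 (hz0 _ hx.2)
    · exact continuousOn_modTheta_comp hq ((continuousOn_snd.pow 2).inv₀ fun x hx =>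
        pow_ne_zero 2 (hz0 _ hx.2)) fun x hx => inv_ne_zero (pow_ne_zero 2 (hz0 _ hx.2))
  have hsymm : H 1 (-Complex.I) = H 1 Complex.I := by
    simp only [hH, hX, inv_neg, Complex.inv_I, neg_neg, neg_sq]
    simp only [mul_comm (ellipticGamma (v 1 _ * -Complex.I) p q)]
    ring
  have hlim := tendsto_circleAverage_sqPoissonKernel h0 h1 hHc rfl hsymm
  set Y : ℝ → ℂ := fun r => (∏ m, ellipticGamma (Complex.I * r * v r m) p q) *
    (∏ m, ellipticGamma (-(Complex.I * r) * v r m) p q) *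
    ∏ m, ∏ n ∈ Finset.Ioi m, ellipticGamma (v r m * v r n) p q with hY
  set Z : ℝ → ℂ := fun r => L * ((1 + (r : ℂ) ^ 2) * regEllipticGamma ((r : ℂ) ^ 2) p q * Y r)
    with hZ
  have hZc : ContinuousOn Z (Set.Icc r₀ 1) := by
    have hrc : ContinuousOn (fun r : ℝ => Complex.I * (r : ℂ)) (Set.Icc r₀ 1) := by fun_prop
    have hrI : ∀ r ∈ Set.Icc r₀ 1, ‖Complex.I * r‖ ≤ 1 := fun r hr => by
      rw [norm_mul, Complex.norm_I, one_mul]; exact hrn r hr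
    have hI0 : ∀ r ∈ Set.Icc r₀ 1, Complex.I * r ≠ 0 := fun r hr =>
      mul_ne_zero Complex.I_ne_zero (hr0 r hr)
    refine continuousOn_const.mul (ContinuousOn.mul (ContinuousOn.mul (by fun_prop) ?_)
      (ContinuousOn.mul (ContinuousOn.mul (continuousOn_finsetProd _ fun m _ => ?_)
        (continuousOn_finsetProd _ fun m _ => ?_))
        (continuousOn_finsetProd _ fun m _ => continuousOn_finsetProd _ fun n _ => ?_)))
    · refine continuousOn_regEllipticGamma_comp hp hq (by fun_prop) fun r hr =>
        ⟨pow_ne_zero 2 (hr0 r hr), ?_⟩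
      rw [norm_pow]
      exact pow_le_one₀ (norm_nonneg _) (hrn r hr)
    · refine continuousOn_ellipticGamma_comp hp hq (hrc.mul (hvc m)) fun r hr =>
        ⟨mul_ne_zero (hI0 r hr) (hv0 r hr m), ?_⟩
      rw [mul_comm]
      exact norm_mul_lt_one_of_le (hv r hr m) (hrI r hr)
    · refine continuousOn_ellipticGamma_comp hp hq (hrc.neg.mul (hvc m)) fun r hr =>
        ⟨mul_ne_zero (neg_ne_zero.2 (hI0 r hr)) (hv0 r hr m), ?_⟩
      rw [mul_comm]
      exact norm_mul_lt_one_of_le (hv r hr m) (by rw [norm_neg]; exact hrI r hr)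
    · exact continuousOn_ellipticGamma_comp hp hq ((hvc m).mul (hvc n)) fun r hr =>
        ⟨mul_ne_zero (hv0 r hr m) (hv0 r hr n), norm_mul_lt_one_of_le (hv r hr m) (hv r hr n).le⟩
  have hmean : ∀ r ∈ Set.Ico r₀ 1,
      Real.circleAverage (fun z => (sqPoissonKernel (r ^ 2) z : ℂ) * H r z) 0 1 = Z r := by
    intro r hr
    have hrI : r ∈ Set.Icc r₀ 1 := ⟨hr.1, hr.2.le⟩
    have hrpos : 0 < r := h0.trans_le hr.1
    have hr21 : r ^ 2 < 1 := by nlinarith [hr.2]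
    have hIr : ‖Complex.I * r‖ < 1 := by
      rw [norm_mul, Complex.norm_I, one_mul, Complex.norm_real, Real.norm_of_nonneg hrpos.le]
      exact hr.2
    have hW : Set.EqOn (fun z => (sqPoissonKernel (r ^ 2) z : ℂ) * H r z)
        ((1 - (r : ℂ) ^ 4) • betaWeight p q
          (vecCons (Complex.I * r) (vecCons (-(Complex.I * r)) (v r)))) (Metric.sphere 0 |1|) := by
      intro z hz
      have hz1 : ‖z‖ = 1 := by simpa using hz
      have hzz : z ≠ 0 := by rintro rfl; simp at hz1
      simp only [Pi.smul_apply, smul_eq_mul, hH, betaWeight]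
      rw [ofReal_sqPoissonKernel hz1, prod_vecCons_vecCons
        (fun y => ellipticGamma (y * z) p q * ellipticGamma (y * z⁻¹) p q)]
      simp only [ellipticGamma_eq_regEllipticGamma_div hp hq (Complex.I * r * z),
        ellipticGamma_eq_regEllipticGamma_div hp hq (Complex.I * r * z⁻¹),
        ellipticGamma_eq_regEllipticGamma_div hp hq (-(Complex.I * r) * z),
        ellipticGamma_eq_regEllipticGamma_div hp hq (-(Complex.I * r) * z⁻¹)]
      have e1 : (1 + ((r ^ 2 : ℝ) : ℂ) * z ^ 2) =
          (1 - Complex.I * r * z) * (1 - -(Complex.I * r) * z) := by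
        push_cast
        linear_combination (r : ℂ) ^ 2 * z ^ 2 * Complex.I_sq
      have e2 : (1 + ((r ^ 2 : ℝ) : ℂ) * (z ^ 2)⁻¹) =
          (1 - Complex.I * r * z⁻¹) * (1 - -(Complex.I * r) * z⁻¹) := by
        push_cast
        rw [← inv_pow]
        linear_combination (r : ℂ) ^ 2 * z⁻¹ ^ 2 * Complex.I_sq
      rw [e1, e2]
      push_cast
      simp only [div_eq_mul_inv, mul_inv, hX]
      ring
    rw [Real.circleAverage_congr_sphere hW, Real.circleAverage_smul]
    have hbal := isBalanced_vecCons (p := p) (q := q) hIr (by rwa [norm_neg]) (hv r hrI)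
      (by rw [← hvp r hrI]; linear_combination -((r : ℂ) ^ 2 * ∏ m, v r m) * Complex.I_sq)
    have hR := hbal.betaProd_ne_zero hp0 hq0 hp hq
    have hJ := hL r hr
    rw [betaRatio, div_eq_iff hR] at hJ
    change (1 - (r : ℂ) ^ 4) • betaMean p q _ = _
    have e3 : Complex.I * r * -(Complex.I * r) = (r : ℂ) ^ 2 := by
      linear_combination -(r : ℂ) ^ 2 * Complex.I_sq
    rw [hJ, betaProd_vecCons, e3, ellipticGamma_eq_regEllipticGamma_div hp hq ((r : ℂ) ^ 2)]
    have hne : (1 : ℂ) - (r : ℂ) ^ 2 ≠ 0 := by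
      rw [sub_ne_zero]
      exact_mod_cast hr21.ne'
    simp only [hZ, hY, smul_eq_mul]
    field_simp
    ring
  have hZlim : Tendsto Z (𝓝[<] 1) (𝓝 (Z 1)) := by
    refine (hZc 1 ⟨h1.le, le_rfl⟩).mono_left ?_
    rw [← nhdsWithin_Ico_eq_nhdsLT h1]
    exact nhdsWithin_mono _ Set.Ico_subset_Icc_self
  have heq : H 1 Complex.I = Z 1 := by
    refine tendsto_nhds_unique hlim (hZlim.congr' ?_)
    filter_upwards [Ico_mem_nhdsLT h1] with r hr using (hmean r hr).symm
  -- both sides at `r = 1`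
  have m1 : (1 : ℝ) ∈ Set.Icc r₀ 1 := ⟨h1.le, le_rfl⟩
  have hvp1 : ∏ m, v 1 m = p * q := by simpa using hvp 1 m1
  have hpair := prod_pair_ellipticGamma_eq_one hp0 hq0 hp hq (hv 1 m1) hvp1
  have hXne : X 1 Complex.I ≠ 0 := by
    refine Finset.prod_ne_zero_iff.2 fun m _ => ?_
    have key : ∀ w : ℂ, ‖w‖ = 1 → ellipticGamma (v 1 m * w) p q ≠ 0 := by
      intro w hw
      refine ellipticGamma_ne_zero hp hq (norm_mul_lt_one_of_norm_eq_one (hv 1 m1 m) hw) ?_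
      rw [← hvp1, ← Finset.mul_prod_erase _ _ (Finset.mem_univ m),
        mul_div_mul_left _ _ (hv0 1 m1 m), norm_div, hw, div_one]
      refine norm_prod_lt_one (hv 1 m1) _ (Finset.card_pos.1 ?_)
      rw [Finset.card_erase_of_mem (Finset.mem_univ m)]
      simp
    exact mul_ne_zero (key _ Complex.norm_I) (key _ (by simp))
  have hYX : Y 1 = X 1 Complex.I := by
    simp only [hY, hX, Complex.ofReal_one, mul_one, hpair, Complex.inv_I, Finset.prod_mul_distrib]
    simp only [mul_comm Complex.I, mul_comm (-Complex.I)]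
  have hg := regEllipticGamma_ne_zero (p := p) (q := q) hp hq (z := 1) (by simp)
  have h4 := regEllipticGamma_neg_one_sq (p := p) (q := q) hp hq
  have hII : Complex.I * Complex.I = -1 := Complex.I_mul_I
  have heq2 : 4 * regEllipticGamma 1 p q ^ 2 * X 1 Complex.I =
      L * (2 * regEllipticGamma 1 p q * X 1 Complex.I) := by
    have e := heq
    simp only [hZ, hYX, hH, Complex.ofReal_one, mul_one, one_pow, Complex.inv_I, mul_neg, neg_mul,
      hII, neg_neg, Complex.I_sq] at e
    rw [show ((-1 : ℂ))⁻¹ = -1 by norm_num] at e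
    rw [← h4]
    linear_combination e
  have hLval : L = 2 * regEllipticGamma 1 p q := by
    refine mul_right_cancel₀ (mul_ne_zero (mul_ne_zero two_ne_zero hg) hXne) ?_
    linear_combination -heq2
  have h2 := qPochhammerInf_ne_zero_of_norm_lt_one hp hp
  have h3 := qPochhammerInf_ne_zero_of_norm_lt_one hq hq
  rw [hLval, regEllipticGamma_one hp hq]
  field_simp

end

/-! ### Evaluation of the integral -/

section

variable {p q : ℂ}

theorem prod_prod_Ioi_eq_prod_sym2 {n : ℕ} {M : Type*} [CommMonoid M] (f : Sym2 (Fin n) → M) :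
    ∏ j, ∏ k ∈ Finset.Ioi j, f s(j, k) = ∏ e : Sym2 (Fin n) with ¬ e.IsDiag, f e := by
  rw [Finset.prod_sigma']
  refine Finset.prod_bij (fun x _ => s(x.1, x.2)) ?_ ?_ ?_ fun _ _ => rfl
  · rintro ⟨j, k⟩ h
    simpa using (by simpa using h : j < k).ne
  · rintro ⟨j, k⟩ h ⟨j', k'⟩ h' e
    have h1 : j < k := by simpa using h
    have h2 : j' < k' := by simpa using h'
    rcases Sym2.eq_iff.1 e with ⟨rfl, rfl⟩ | ⟨rfl, rfl⟩
    · rfl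
    · exact absurd h1 h2.asymm
  · intro e he
    induction e with | _ j k =>
    have hjk : j ≠ k := by simpa using he
    rcases hjk.lt_or_gt with h | h
    · exact ⟨⟨j, k⟩, by simpa using h, rfl⟩
    · exact ⟨⟨k, j⟩, by simpa using h, Sym2.eq_swap⟩

theorem betaProd_comp_perm (t : Fin 6 → ℂ) (σ : Equiv.Perm (Fin 6)) :
    betaProd p q (t ∘ σ) = betaProd p q t := by
  have h : ∀ t : Fin 6 → ℂ, betaProd p q t = ∏ e : Sym2 (Fin 6) with ¬ e.IsDiag,
      Sym2.lift ⟨fun j k => ellipticGamma (t j * t k) p q,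
        fun j k => by simp only [mul_comm]⟩ e := fun t => by
    rw [← prod_prod_Ioi_eq_prod_sym2]; rfl
  rw [h, h]
  refine Finset.prod_nbij' (Sym2.map σ) (Sym2.map σ.symm) ?_ ?_ ?_ ?_ ?_
  all_goals
    intro e he
    induction e with | _ j k => simp_all

theorem betaRatio_comp_perm (t : Fin 6 → ℂ) (σ : Equiv.Perm (Fin 6)) :
    betaRatio p q (t ∘ σ) = betaRatio p q t := by
  have h : betaWeight p q (t ∘ σ) = betaWeight p q t := by
    funext z
    unfold betaWeight
    rw [← Equiv.prod_comp σ (fun j => ellipticGamma (t j * z) p q * ellipticGamma (t j * z⁻¹) p q)]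
    rfl
  rw [betaRatio, betaRatio, betaProd_comp_perm, betaMean, betaMean, h]

theorem IsBalanced.comp_perm {t : Fin 6 → ℂ} (ht : IsBalanced p q t) (σ : Equiv.Perm (Fin 6)) :
    IsBalanced p q (t ∘ σ) :=
  ⟨fun j => ht.norm_lt_one (σ j), (Equiv.prod_comp σ t).trans ht.prod_eq⟩

theorem betaRatio_swap (σ : Equiv.Perm (Fin 6)) {t t' : Fin 6 → ℂ} (h : t ∘ σ = t') :
    betaRatio p q t' = betaRatio p q t := by
  rw [← h, betaRatio_comp_perm]

theorem IsBalanced.prod_eq_vecCons {a b c d e f : ℂ} (ht : IsBalanced p q ![a, b, c, d, e, f]) :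
    a * b * ∏ m, ![c, d, e, f] m = p * q :=
  (prod_vecCons_vecCons id a b ![c, d, e, f]).symm.trans ht.prod_eq

theorem norm_vecCons_four_lt_one {c d e f : ℂ} (hc : ‖c‖ < 1) (hd : ‖d‖ < 1) (he : ‖e‖ < 1)
    (hf : ‖f‖ < 1) (m : Fin 4) : ‖![c, d, e, f] m‖ < 1 := by
  fin_cases m
  exacts [hc, hd, he, hf]

/-- The parameters are moved to `(i r, -i r, a b c / r², d, e, f)` for all `r` close to `1`. -/
theorem betaRatio_eval_of_norm_mul_lt (hp0 : p ≠ 0) (hq0 : q ≠ 0) (hp : ‖p‖ < 1) (hq : ‖q‖ < 1)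
    {a b c d e f : ℂ} (ht : IsBalanced p q ![a, b, c, d, e, f]) (hab : ‖a * b‖ < ‖q‖) :
    qPochhammerInf p p * qPochhammerInf q q / 2 * betaRatio p q ![a, b, c, d, e, f] = 1 := by
  have ha0 : a ≠ 0 := ht.ne_zero hp0 hq0 0
  have hb0 : b ≠ 0 := ht.ne_zero hp0 hq0 1
  have ha : ‖a‖ < 1 := ht.norm_lt_one 0
  have hb : ‖b‖ < 1 := ht.norm_lt_one 1
  have hc : ‖c‖ < 1 := ht.norm_lt_one 2
  have hd : ‖d‖ < 1 := ht.norm_lt_one 3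
  have he : ‖e‖ < 1 := ht.norm_lt_one 4
  have hf : ‖f‖ < 1 := ht.norm_lt_one 5
  have hprod := ht.prod_eq_vecCons
  have hprod' : a * b * c * d * e * f = p * q := by
    rw [← hprod, Fin.prod_univ_four]
    simp only [cons_val_zero, cons_val_one, cons_val]
    ring
  have hqn : 0 < ‖q‖ := norm_pos_iff.2 hq0
  have habc : ‖a * b * c‖ < ‖q‖ := by
    rw [norm_mul]
    exact (mul_le_of_le_one_right (norm_nonneg _) hc.le).trans_lt hab
  obtain ⟨R, hR, hR1⟩ : ∃ R, max ‖q‖ (‖a * b * c‖ / ‖q‖) < R ∧ R < 1 :=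
    exists_between (max_lt hq ((div_lt_one hqn).2 habc))
  have hRq : ‖q‖ < R := (le_max_left _ _).trans_lt hR
  have hRabc : ‖a * b * c‖ < R * ‖q‖ := (div_lt_iff₀ hqn).1 ((le_max_right _ _).trans_lt hR)
  have hR0 : 0 < R := hqn.trans hRq
  have hval : ∀ r ∈ Set.Icc R 1, ‖((r : ℝ) : ℂ)‖ = r := fun r hr => by
    rw [Complex.norm_real, Real.norm_of_nonneg (hR0.le.trans hr.1)]
  have hne : ∀ r ∈ Set.Icc R 1, ((r : ℝ) : ℂ) ≠ 0 := fun r hr =>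
    Complex.ofReal_ne_zero.2 (hR0.trans_le hr.1).ne'
  refine betaRatio_eq_of_eq_on_family hp0 hq0 hp hq hR0 hR1
    (v := fun r => ![a * b * c / (r : ℂ) ^ 2, d, e, f]) ?_ ?_ ?_ ?_
  · intro m
    fin_cases m
    · exact continuousOn_const.div (by fun_prop) fun r hr => pow_ne_zero 2 (hne r hr)
    all_goals exact continuousOn_const
  · intro r hr
    refine norm_vecCons_four_lt_one ?_ hd he hf
    rw [norm_div, norm_pow, hval r hr, div_lt_one (pow_pos (hR0.trans_le hr.1) 2)]
    nlinarith [hr.1]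
  · intro r hr
    have := hne r hr
    rw [← hprod', Fin.prod_univ_four]
    simp only [cons_val_zero, cons_val_one, cons_val]
    field_simp
  · intro r hr
    have hrI : r ∈ Set.Icc R 1 := ⟨hr.1, hr.2.le⟩
    have hr0 := hne r hrI
    have hIr : Complex.I * (r : ℂ) ≠ 0 := mul_ne_zero Complex.I_ne_zero hr0
    have hIrn : ‖Complex.I * (r : ℂ)‖ = r := by rw [norm_mul, Complex.norm_I, one_mul, hval r hrI]
    have hIr2 : (Complex.I * (r : ℂ)) * (Complex.I * (r : ℂ)) = -(r : ℂ) ^ 2 := by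
      linear_combination (r : ℂ) ^ 2 * Complex.I_sq
    -- move `(a, b)` to `(i r, a b / (i r))`
    have move1 := betaRatio_eq_of_norm_lt hp0 hq0 hp hq (norm_vecCons_four_lt_one hc hd he hf)
      hprod hab (x := a) (y := Complex.I * r)
      ⟨by rw [norm_mul]; exact mul_lt_of_lt_one_right (norm_pos_iff.2 ha0) hb, ha⟩
      ⟨by rw [hIrn]; linarith [hr.1], by rw [hIrn]; exact hr.2⟩
    rw [mul_div_cancel_left₀ _ ha0] at move1
    -- move `(c, a b / (i r))` to `(-i r, a b c / r²)`
    have hBn : ‖c * (a * b / (Complex.I * r))‖ < ‖q‖ := by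
      rw [show c * (a * b / (Complex.I * r)) = a * b * c / (Complex.I * r) by ring, norm_div,
        hIrn, div_lt_iff₀ (hR0.trans_le hr.1)]
      nlinarith [hr.1]
    have hb' : ‖a * b / (Complex.I * r)‖ < 1 := by
      rw [norm_div, hIrn, div_lt_one (hR0.trans_le hr.1)]
      linarith [hr.1]
    have hc0 : c ≠ 0 := ht.ne_zero hp0 hq0 2
    have move2 := betaRatio_eq_of_norm_lt hp0 hq0 hp hq
      (norm_vecCons_four_lt_one (c := Complex.I * r) (by rw [hIrn]; exact hr.2) hd he hf)
      (B := c * (a * b / (Complex.I * r)))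
      (by
        rw [← hprod', Fin.prod_univ_four]
        simp only [cons_val_zero, cons_val_one, cons_val]
        field_simp) hBn (x := c) (y := -(Complex.I * r))
      ⟨by rw [norm_mul]; exact mul_lt_of_lt_one_right (norm_pos_iff.2 hc0) hb', hc⟩
      ⟨by rw [norm_neg, hIrn]; linarith [hr.1], by rw [norm_neg, hIrn]; exact hr.2⟩
    rw [mul_div_cancel_left₀ _ hc0] at move2
    have e1 : c * (a * b / (Complex.I * r)) / (-(Complex.I * r)) = a * b * c / (r : ℂ) ^ 2 := by
      rw [← mul_div_assoc, div_div, mul_neg, hIr2, neg_neg]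
      ring
    rw [e1] at move2
    refine Eq.trans ?_ (move2.symm.trans (Eq.trans ?_ move1.symm))
    · refine betaRatio_swap (c[0, 2, 1] : Equiv.Perm (Fin 6)) ?_
      funext i; fin_cases i <;> rfl
    · refine betaRatio_swap (Equiv.swap 0 2) ?_
      funext i; fin_cases i <;> rfl

/-- For fixed `a b` the products `x c` with `|x|` small satisfy the previous condition. -/
theorem betaRatio_eval_of_norm_mul_mul_lt (hp0 : p ≠ 0) (hq0 : q ≠ 0) (hp : ‖p‖ < 1)
    (hq : ‖q‖ < 1) {a b c d e f : ℂ} (ht : IsBalanced p q ![a, b, c, d, e, f])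
    (habc : ‖a * b * c‖ < ‖q‖) :
    qPochhammerInf p p * qPochhammerInf q q / 2 * betaRatio p q ![a, b, c, d, e, f] = 1 := by
  have ha0 : a ≠ 0 := ht.ne_zero hp0 hq0 0
  have hc0 : c ≠ 0 := ht.ne_zero hp0 hq0 2
  have hs := norm_vecCons_four_lt_one (c := c) (d := d) (e := e) (f := f) (ht.norm_lt_one 2)
    (ht.norm_lt_one 3) (ht.norm_lt_one 4) (ht.norm_lt_one 5)
  have hK : qPochhammerInf p p * qPochhammerInf q q / 2 ≠ 0 :=
    div_ne_zero (mul_ne_zero (qPochhammerInf_ne_zero_of_norm_lt_one hp hp)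
      (qPochhammerInf_ne_zero_of_norm_lt_one hq hq)) two_ne_zero
  rw [← eq_inv_mul_iff_mul_eq₀ hK]
  have key := betaRatio_eq_of_forall_norm_lt hp0 hq0 hp hq hs ht.prod_eq_vecCons
    (ρ := ‖q‖ / ‖c‖) (by
      rw [lt_div_iff₀ (norm_pos_iff.2 hc0), ← norm_mul]; exact habc)
    (c := (qPochhammerInf p p * qPochhammerInf q q / 2)⁻¹ * 1) (x := a) ?_
    ⟨by rw [norm_mul]; exact mul_lt_of_lt_one_right (norm_pos_iff.2 ha0) (ht.norm_lt_one 1),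
      ht.norm_lt_one 0⟩
  · rw [mul_div_cancel_left₀ _ ha0] at key
    exact key
  · intro x hx1 hx2 hx3
    have hbal := isBalanced_vecCons_div (p := p) (q := q) hs ht.prod_eq_vecCons ⟨hx1, hx2⟩
    have e1 : (vecCons x (vecCons (a * b / x) ![c, d, e, f])) ∘ (Equiv.swap 1 2 :
        Equiv.Perm (Fin 6)) = ![x, c, a * b / x, d, e, f] := by
      funext i; fin_cases i <;> rfl
    rw [← betaRatio_swap _ e1, eq_inv_mul_iff_mul_eq₀ hK]
    refine betaRatio_eval_of_norm_mul_lt hp0 hq0 hp hq (e1 ▸ hbal.comp_perm _) ?_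
    rwa [norm_mul, ← lt_div_iff₀ (norm_pos_iff.2 hc0)]

/-- For fixed `a b` the products `x c d` with `|x|` small satisfy the previous condition. -/
theorem betaRatio_eval_of_norm_mul_mul_mul_lt (hp0 : p ≠ 0) (hq0 : q ≠ 0) (hp : ‖p‖ < 1)
    (hq : ‖q‖ < 1) {a b c d e f : ℂ} (ht : IsBalanced p q ![a, b, c, d, e, f])
    (habcd : ‖a * b * c * d‖ < ‖q‖) :
    qPochhammerInf p p * qPochhammerInf q q / 2 * betaRatio p q ![a, b, c, d, e, f] = 1 := by
  have ha0 : a ≠ 0 := ht.ne_zero hp0 hq0 0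
  have hc0 : c ≠ 0 := ht.ne_zero hp0 hq0 2
  have hd0 : d ≠ 0 := ht.ne_zero hp0 hq0 3
  have hs := norm_vecCons_four_lt_one (c := c) (d := d) (e := e) (f := f) (ht.norm_lt_one 2)
    (ht.norm_lt_one 3) (ht.norm_lt_one 4) (ht.norm_lt_one 5)
  have hK : qPochhammerInf p p * qPochhammerInf q q / 2 ≠ 0 :=
    div_ne_zero (mul_ne_zero (qPochhammerInf_ne_zero_of_norm_lt_one hp hp)
      (qPochhammerInf_ne_zero_of_norm_lt_one hq hq)) two_ne_zero
  have hcd : 0 < ‖c * d‖ := norm_pos_iff.2 (mul_ne_zero hc0 hd0)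
  rw [← eq_inv_mul_iff_mul_eq₀ hK]
  have key := betaRatio_eq_of_forall_norm_lt hp0 hq0 hp hq hs ht.prod_eq_vecCons
    (ρ := ‖q‖ / ‖c * d‖) (by
      rw [lt_div_iff₀ hcd, ← norm_mul, ← mul_assoc]; exact habcd)
    (c := (qPochhammerInf p p * qPochhammerInf q q / 2)⁻¹ * 1) (x := a) ?_
    ⟨by rw [norm_mul]; exact mul_lt_of_lt_one_right (norm_pos_iff.2 ha0) (ht.norm_lt_one 1),
      ht.norm_lt_one 0⟩
  · rw [mul_div_cancel_left₀ _ ha0] at key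
    exact key
  · intro x hx1 hx2 hx3
    have hbal := isBalanced_vecCons_div (p := p) (q := q) hs ht.prod_eq_vecCons ⟨hx1, hx2⟩
    have e1 : (vecCons x (vecCons (a * b / x) ![c, d, e, f])) ∘ (c[1, 2, 3] :
        Equiv.Perm (Fin 6)) = ![x, c, d, a * b / x, e, f] := by
      funext i; fin_cases i <;> rfl
    rw [← betaRatio_swap _ e1, eq_inv_mul_iff_mul_eq₀ hK]
    refine betaRatio_eval_of_norm_mul_mul_lt hp0 hq0 hp hq (e1 ▸ hbal.comp_perm _) ?_
    rwa [mul_assoc, norm_mul, ← lt_div_iff₀ hcd]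

/-- The four smallest parameters have a product of modulus less than `|q|`, if `|p| ≤ |q|`. -/
theorem betaRatio_eval (hp0 : p ≠ 0) (hq0 : q ≠ 0) (hp : ‖p‖ < 1) (hq : ‖q‖ < 1)
    (hpq : ‖p‖ ≤ ‖q‖) {t : Fin 6 → ℂ} (ht : IsBalanced p q t) :
    qPochhammerInf p p * qPochhammerInf q q / 2 * betaRatio p q t = 1 := by
  rw [← betaRatio_comp_perm t (Tuple.sort fun j => ‖t j‖)]
  have hmono : ∀ i j : Fin 6, i ≤ j → ‖(t ∘ Tuple.sort fun j => ‖t j‖) i‖ ≤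
      ‖(t ∘ Tuple.sort fun j => ‖t j‖) j‖ := fun i j hij =>
    Tuple.monotone_sort (fun j => ‖t j‖) hij
  have hbal := ht.comp_perm (Tuple.sort fun j => ‖t j‖)
  generalize (t ∘ Tuple.sort fun j => ‖t j‖) = s at hmono hbal ⊢
  have es : s = ![s 0, s 1, s 2, s 3, s 4, s 5] := by
    funext i; fin_cases i <;> rfl
  have hprod := congrArg norm hbal.prod_eq
  rw [norm_mul, norm_prod, Fin.prod_univ_six] at hprod
  rw [es]
  refine betaRatio_eval_of_norm_mul_mul_mul_lt hp0 hq0 hp hq (es ▸ hbal) ?_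
  rw [norm_mul, norm_mul, norm_mul]
  have hqn : 0 < ‖q‖ := norm_pos_iff.2 hq0
  have h01 : ‖s 0‖ * ‖s 1‖ ≤ ‖s 4‖ * ‖s 5‖ :=
    mul_le_mul (hmono 0 4 (by decide)) (hmono 1 5 (by decide)) (norm_nonneg _) (norm_nonneg _)
  have h23 : ‖s 2‖ * ‖s 3‖ ≤ ‖s 4‖ * ‖s 5‖ :=
    mul_le_mul (hmono 2 4 (by decide)) (hmono 3 5 (by decide)) (norm_nonneg _) (norm_nonneg _)
  by_contra hcon
  push Not at hcon
  set Y := ‖s 4‖ * ‖s 5‖ with hY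
  have hY0 : 0 ≤ Y := by positivity
  have hxy : ‖s 0‖ * ‖s 1‖ * ‖s 2‖ * ‖s 3‖ * Y ≤ ‖q‖ * ‖q‖ := by
    calc _ = ‖p‖ * ‖q‖ := by rw [← hprod, hY]; ring
      _ ≤ _ := by gcongr
  have hYq : Y ≤ ‖q‖ := by
    have := mul_le_mul_of_nonneg_right hcon hY0
    nlinarith
  have h4 : ‖s 0‖ * ‖s 1‖ * ‖s 2‖ * ‖s 3‖ ≤ Y * Y := by
    rw [mul_assoc (‖s 0‖ * ‖s 1‖)]
    exact mul_le_mul h01 h23 (by positivity) hY0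
  nlinarith

theorem ellipticBetaIntegrand_symm (hp : ‖p‖ < 1) (hq : ‖q‖ < 1) (t : Fin 6 → ℂ) :
    ellipticBetaIntegrand t p q = ellipticBetaIntegrand t q p := by
  have h : ∀ z, ellipticGamma z p q = ellipticGamma z q p := ellipticGamma_symm hp hq
  funext z
  simp only [ellipticBetaIntegrand, h]

theorem ellipticBetaIntegrand_eq_betaWeight (hp : ‖p‖ < 1) (hq : ‖q‖ < 1) (t : Fin 6 → ℂ) {z : ℂ}
    (hz : ‖z‖ = 1) : ellipticBetaIntegrand t p q z = z⁻¹ • betaWeight p q t z := by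
  rw [ellipticBetaIntegrand, betaWeight, div_eq_mul_inv,
    inv_ellipticGamma_mul_inv hp hq (by rw [norm_pow, hz, one_pow]), smul_eq_mul, one_div,
    mul_comm]

theorem ellipticBetaIntegral_of_norm_le (hp0 : p ≠ 0) (hq0 : q ≠ 0) (hp : ‖p‖ < 1) (hq : ‖q‖ < 1)
    (hpq : ‖p‖ ≤ ‖q‖) {t : Fin 6 → ℂ} (ht : IsBalanced p q t) :
    CircleIntegrable (ellipticBetaIntegrand t p q) 0 1 ∧
      qPochhammerInf p p * qPochhammerInf q q / (4 * (Real.pi : ℂ) * Complex.I) *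
          (∮ z in C(0, 1), ellipticBetaIntegrand t p q z) =
        ∏ j : Fin 6, ∏ k ∈ Finset.Ioi j, ellipticGamma (t j * t k) p q := by
  have hEq : Set.EqOn (ellipticBetaIntegrand t p q) (fun z => (z - 0)⁻¹ • betaWeight p q t z)
      (Metric.sphere 0 1) := fun z hz => by
    simpa only [sub_zero] using
      ellipticBetaIntegrand_eq_betaWeight hp hq t (mem_sphere_zero_iff_norm.1 hz)
  constructor
  · refine ContinuousOn.circleIntegrable zero_le_one (ContinuousOn.congr ?_ hEq)
    refine ContinuousOn.fun_smul ?_ (continuousOn_betaWeight_sphere hp hq fun j =>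
      ⟨ht.ne_zero hp0 hq0 j, ht.norm_lt_one j⟩)
    refine ContinuousOn.inv₀ (by fun_prop) fun z hz => ?_
    rw [sub_zero]
    rintro rfl
    simp at hz
  · have hmean : betaMean p q t =
        (2 * Real.pi * Complex.I)⁻¹ • ∮ z in C(0, 1), ellipticBetaIntegrand t p q z := by
      rw [betaMean, Real.circleAverage_eq_circleIntegral one_ne_zero,
        circleIntegral.integral_congr zero_le_one hEq]
    have heval := betaRatio_eval hp0 hq0 hp hq hpq ht
    rw [betaRatio, ← mul_div_assoc, div_eq_one_iff_eq (ht.betaProd_ne_zero hp0 hq0 hp hq), hmean,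
      smul_eq_mul] at heval
    change _ = betaProd p q t
    rw [← heval]
    have hpi : (Real.pi : ℂ) ≠ 0 := Complex.ofReal_ne_zero.2 Real.pi_ne_zero
    field_simp
    ring

end

theorem theorem1 (p q : ℂ) (t : Fin 6 → ℂ)
    (hp0 : p ≠ 0) (hq0 : q ≠ 0) (hp : ‖p‖ < 1) (hq : ‖q‖ < 1)
    (ht : ∀ j, ‖t j‖ < 1) (hprod : ∏ j, t j = p * q) :
    CircleIntegrable (ellipticBetaIntegrand t p q) 0 1 ∧
      qPochhammerInf p p * qPochhammerInf q q / (4 * (Real.pi : ℂ) * Complex.I) *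
          (∮ z in C(0, 1), ellipticBetaIntegrand t p q z) =
        ∏ j : Fin 6, ∏ k ∈ Finset.Ioi j, ellipticGamma (t j * t k) p q := by
  rcases le_total ‖p‖ ‖q‖ with hpq | hpq
  · exact ellipticBetaIntegral_of_norm_le hp0 hq0 hp hq hpq ⟨ht, hprod⟩
  · have h := ellipticBetaIntegral_of_norm_le hq0 hp0 hq hp hpq ⟨ht, by rw [hprod, mul_comm]⟩
    have hs : ∀ z, ellipticGamma z p q = ellipticGamma z q p := ellipticGamma_symm hp hq
    simp only [ellipticBetaIntegrand_symm hp hq, hs, mul_comm (qPochhammerInf p p)]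
    exact h
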